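/- Let $\mathcal P$ be the $\mathbb C$-algebra of formal pseudodifferential operators $\sum_{j\le n}u_j(x)\partial^j$ ($n\in\mathbb Z$, $u_j\in\mathbb C[[x]]$) with product determined by $\partial^k u=\sum_{i\ge 0}\binom{k}{i}u^{(i)}\partial^{k-i}$ for $k\in\mathbb Z$, and let $\mathcal D\subset\mathcal P$ be the subalgebra of differential operators (no negative powers of $\partial$). A fractional differential operator is an $L\in\mathcal P$ of the form $L=PQ^{-1}$ with $P,Q\in\mathcal D$, $Q\ne 0$ (the quotient being taken in the skew field of fractions of $\mathcal D$, i.e. $LQ=P$). It is normalized of order $m\in\mathbb Z$ if $L=\partial^m+0\cdot\partial^{m-1}+(\text{lower order terms})$. A commutative algebra of fractional differential operators is a commutative (unital) $\mathbb C$-subalgebra of $\mathcal P$ all of whose elements are fractional differential operators; it is maximal if it is not properly contained in another one. Let $\mathbb L=\mathbb C((z^{-1}))$, $\mathbb L_+=\mathbb C[z]$, $\mathbb L_-=z^{-1}\mathbb C[[z^{-1}]]$, and let $\pi_+:\mathbb L=\mathbb L_+\oplus\mathbb L_-\to\mathbb L_+$ be the projection. The big cell $\mathrm{Gr}_+(0)$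 consists of the subspaces $W\subseteq\mathbb L$ such that $\pi_+|_W:W\to\mathbb L_+$ is an isomorphism. $\mathcal P$ acts on $\mathbb L$ from the right through the identification $\mathbb L\cong\mathcal P/x\mathcal P$, $z^j\leftrightarrow\partial^j$. For $f=\sum_j f_jz^j\in\mathbb L$ put $f(\partial)=\sum_j f_j\partial^j$. For a subspace $W\subseteq\mathbb L$ put $K_W=\{f\in\mathbb L:\dim (W+fW)/W<\infty\}$. **Theorem.** (1) Let $W\in\mathrm{Gr}_+(0)$ and let $U=1+\sum_{j\ge1}u_j(x)\partial^{-j}\in\mathcal P$ be such that $W=\mathbb L_+\cdot U$. Then $$\mathscr K_W=\{U f(\partial)U^{-1}: f\in K_W\}$$ is a commutative algebra of fractional differential operators, and it is maximal if $K_W\ne\mathbb C$. (2) Every maximal commutative algebra of fractional differential operators that contains a normalized fractional differential operator of some order $m\neq 0$ arises in this way: it equals $\mathscr K_W$ for some $W\in\mathrm{Gr}_+(0)$ with $K_W\ne\mathbb C$ and some $U=1+\sum_{j\ge1}u_j(x)\partial^{-j}$ with $W=\mathbb L_+\cdot U$. -/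

import Mathlib

open scoped PowerSeries LaurentSeries

noncomputable section

namespace SatoFractional

/-! ### Pseudodifferential operators with coefficients in `ℂ⟦x⟧` -/

/-- A formal pseudodifferential operator `∑ⱼ uⱼ(x) ∂ʲ`, with `uⱼ ∈ ℂ⟦x⟧` and `uⱼ = 0` for all
large `j`; `coeff j` is the coefficient `uⱼ`, written to the left of `∂ʲ`. -/
@[ext]
structure PsiDO where
  coeff : ℤ → ℂ⟦X⟧
  bounded : ∃ N : ℤ, ∀ j : ℤ, N < j → coeff j = 0

namespace PsiDO

instance : Zero PsiDO := ⟨⟨0, 0, fun _ _ => rfl⟩⟩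

instance : Add PsiDO :=
  ⟨fun a b => ⟨a.coeff + b.coeff, by
    obtain ⟨A, hA⟩ := a.bounded
    obtain ⟨B, hB⟩ := b.bounded
    exact ⟨max A B, fun j hj => by
      simp [hA j (lt_of_le_of_lt (le_max_left _ _) hj),
        hB j (lt_of_le_of_lt (le_max_right _ _) hj)]⟩⟩⟩

instance : Neg PsiDO :=
  ⟨fun a => ⟨-a.coeff, by
    obtain ⟨A, hA⟩ := a.bounded
    exact ⟨A, fun j hj => by simp [hA j hj]⟩⟩⟩

instance : Sub PsiDO :=
  ⟨fun a b => ⟨a.coeff - b.coeff, by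
    obtain ⟨A, hA⟩ := a.bounded
    obtain ⟨B, hB⟩ := b.bounded
    exact ⟨max A B, fun j hj => by
      simp [hA j (lt_of_le_of_lt (le_max_left _ _) hj),
        hB j (lt_of_le_of_lt (le_max_right _ _) hj)]⟩⟩⟩

instance instSMul {S : Type*} [SMulZeroClass S ℂ⟦X⟧] : SMul S PsiDO :=
  ⟨fun c a => ⟨c • a.coeff, by
    obtain ⟨A, hA⟩ := a.bounded
    exact ⟨A, fun j hj => by simp [hA j hj]⟩⟩⟩

theorem coeff_injective : Function.Injective PsiDO.coeff := fun _ _ h => PsiDO.ext h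

instance : AddCommGroup PsiDO :=
  coeff_injective.addCommGroup _ rfl (fun _ _ => rfl) (fun _ => rfl) (fun _ _ => rfl)
    (fun _ _ => rfl) (fun _ _ => rfl)

/-- The coefficients as an additive map. -/
def coeffHom : PsiDO →+ (ℤ → ℂ⟦X⟧) where
  toFun := PsiDO.coeff
  map_zero' := rfl
  map_add' _ _ := rfl

instance : Module ℂ PsiDO :=
  coeff_injective.module ℂ coeffHom (fun _ _ => rfl)

@[simp] theorem coeff_zero (j : ℤ) : (0 : PsiDO).coeff j = 0 := rfl
@[simp] theorem coeff_add (a b : PsiDO) (j : ℤ) : (a + b).coeff j = a.coeff j + b.coeff j := rfl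
@[simp] theorem coeff_smul (c : ℂ) (a : PsiDO) (j : ℤ) : (c • a).coeff j = c • a.coeff j := rfl

/-- The derivation `d/dx` of `ℂ⟦x⟧`, iterated `k` times. -/
def D (k : ℕ) (u : ℂ⟦X⟧) : ℂ⟦X⟧ := (PowerSeries.derivative ℂ)^[k] u

@[simp] theorem D_zero_left (u : ℂ⟦X⟧) : D 0 u = u := rfl

theorem D_succ (k : ℕ) (u : ℂ⟦X⟧) : D (k + 1) u = PowerSeries.derivative ℂ (D k u) :=
  Function.iterate_succ_apply' _ _ _

@[simp] theorem D_zero (k : ℕ) : D k 0 = 0 := by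
  induction k with
  | zero => rfl
  | succ k ih => rw [D_succ, ih, map_zero]

theorem D_add (k : ℕ) (u v : ℂ⟦X⟧) : D k (u + v) = D k u + D k v := by
  induction k with
  | zero => rfl
  | succ k ih => simp only [D_succ, ih, map_add]

theorem D_smul (k : ℕ) (c : ℂ) (u : ℂ⟦X⟧) : D k (c • u) = c • D k u := by
  induction k with
  | zero => rfl
  | succ k ih => rw [D_succ, D_succ, ih, Derivation.map_smul]

theorem D_succ_one (k : ℕ) : D (k + 1) 1 = 0 := by
  induction k with
  | zero => simp [D_succ]
  | succ k ih => rw [D_succ, ih, map_zero]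

/-- The coefficient of `∂ⁿ` in `∂ⁱ ∘ b`, by the rule `∂ⁱ u = ∑ₖ (i choose k) u⁽ᵏ⁾ ∂ⁱ⁻ᵏ` for
`u ∈ ℂ⟦x⟧` and `i ∈ ℤ`, with generalized binomial coefficients. The sum is finite. -/
def dpow (i : ℤ) (b : PsiDO) (n : ℤ) : ℂ⟦X⟧ :=
  ∑ᶠ k : ℕ, (Ring.choose i k : ℤ) • D k (b.coeff (n + k - i))

theorem dpow_eq_sum (i : ℤ) (b : PsiDO) (n : ℤ) {B : ℤ} (hB : ∀ j, B < j → b.coeff j = 0)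
    {K : ℕ} (hK : B + i - n < K) :
    dpow i b n = ∑ k ∈ Finset.range K, (Ring.choose i k : ℤ) • D k (b.coeff (n + k - i)) := by
  apply finsum_eq_sum_of_support_subset
  intro k hk
  simp only [Finset.coe_range, Set.mem_Iio]
  by_contra h
  apply hk
  have : b.coeff (n + k - i) = 0 := hB _ (by omega)
  simp [this]

theorem dpow_eq_zero (i : ℤ) (b : PsiDO) (n : ℤ) {B : ℤ} (hB : ∀ j, B < j → b.coeff j = 0)
    (hn : B + i < n) : dpow i b n = 0 := by
  rw [dpow_eq_sum i b n hB (K := 0) (by push_cast; omega)]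
  simp

theorem exists_bound (a b : PsiDO) :
    ∃ N : ℤ, (∀ j, N < j → a.coeff j = 0) ∧ ∀ j, N < j → b.coeff j = 0 := by
  obtain ⟨A, hA⟩ := a.bounded
  obtain ⟨B, hB⟩ := b.bounded
  exact ⟨max A B, fun j hj => hA j (lt_of_le_of_lt (le_max_left _ _) hj),
    fun j hj => hB j (lt_of_le_of_lt (le_max_right _ _) hj)⟩

theorem mul_sum_aux (a b : PsiDO) (n : ℤ) {A B lo hi : ℤ} (hA : ∀ j, A < j → a.coeff j = 0)
    (hB : ∀ j, B < j → b.coeff j = 0) (hlo : lo ≤ n - B) (hhi : A ≤ hi) :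
    ∑ᶠ i : ℤ, a.coeff i * dpow i b n = ∑ i ∈ Finset.Icc lo hi, a.coeff i * dpow i b n := by
  apply finsum_eq_sum_of_support_subset
  intro i hi'
  simp only [Finset.coe_Icc, Set.mem_Icc]
  by_contra h
  apply hi'
  by_cases h1 : A < i
  · simp [hA i h1]
  · simp [dpow_eq_zero i b n hB (by omega)]

/-- Composition: `(∑ᵢ aᵢ ∂ⁱ) b = ∑ᵢ aᵢ (∂ⁱ b)`. In each degree the sum is finite. -/
instance : Mul PsiDO :=
  ⟨fun a b => ⟨fun n => ∑ᶠ i : ℤ, a.coeff i * dpow i b n, by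
    obtain ⟨A, hA⟩ := a.bounded
    obtain ⟨B, hB⟩ := b.bounded
    refine ⟨A + B, fun n hn => ?_⟩
    rw [mul_sum_aux a b n hA hB (le_refl _) (le_refl _), Finset.Icc_eq_empty (by omega)]
    simp⟩⟩

theorem coeff_mul (a b : PsiDO) (n : ℤ) :
    (a * b).coeff n = ∑ᶠ i : ℤ, a.coeff i * dpow i b n := rfl

theorem coeff_mul_eq_sum (a b : PsiDO) (n : ℤ) {A B lo hi : ℤ} (hA : ∀ j, A < j → a.coeff j = 0)
    (hB : ∀ j, B < j → b.coeff j = 0) (hlo : lo ≤ n - B) (hhi : A ≤ hi) :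
    (a * b).coeff n = ∑ i ∈ Finset.Icc lo hi, a.coeff i * dpow i b n :=
  mul_sum_aux a b n hA hB hlo hhi

theorem coeff_mul_eq_zero (a b : PsiDO) {A B : ℤ} (hA : ∀ j, A < j → a.coeff j = 0)
    (hB : ∀ j, B < j → b.coeff j = 0) (n : ℤ) (hn : A + B < n) : (a * b).coeff n = 0 := by
  rw [coeff_mul_eq_sum a b n hA hB (le_refl _) (le_refl _), Finset.Icc_eq_empty (by omega)]
  simp

/-- The operator of multiplication by `u ∈ ℂ⟦x⟧` followed by `∂ᵐ` on the right: `u ∂ᵐ`. -/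
def monomial (m : ℤ) (u : ℂ⟦X⟧) : PsiDO :=
  ⟨fun j => if j = m then u else 0, m, fun j hj => by simp [hj.ne']⟩

@[simp] theorem coeff_monomial (m : ℤ) (u : ℂ⟦X⟧) (j : ℤ) :
    (monomial m u).coeff j = if j = m then u else 0 := rfl

instance : One PsiDO := ⟨monomial 0 1⟩

theorem coeff_one (j : ℤ) : (1 : PsiDO).coeff j = if j = 0 then 1 else 0 := rfl

theorem dpow_add (i : ℤ) (b c : PsiDO) (n : ℤ) : dpow i (b + c) n = dpow i b n + dpow i c n := by
  obtain ⟨N, hb, hc⟩ := exists_bound b c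
  have hbc : ∀ j, N < j → (b + c).coeff j = 0 := fun j hj => by simp [hb j hj, hc j hj]
  have hK : N + i - n < ((N + i - n).toNat + 1 : ℕ) := by push_cast; omega
  rw [dpow_eq_sum i _ n hbc hK, dpow_eq_sum i _ n hb hK, dpow_eq_sum i _ n hc hK,
    ← Finset.sum_add_distrib]
  exact Finset.sum_congr rfl fun k _ => by rw [coeff_add, D_add, smul_add]

theorem dpow_smul (i : ℤ) (r : ℂ) (b : PsiDO) (n : ℤ) : dpow i (r • b) n = r • dpow i b n := by
  obtain ⟨N, hb⟩ := b.bounded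
  have hrb : ∀ j, N < j → (r • b).coeff j = 0 := fun j hj => by simp [hb j hj]
  have hK : N + i - n < ((N + i - n).toNat + 1 : ℕ) := by push_cast; omega
  rw [dpow_eq_sum i _ n hrb hK, dpow_eq_sum i _ n hb hK, Finset.smul_sum]
  exact Finset.sum_congr rfl fun k _ => by rw [coeff_smul, D_smul, smul_comm]

theorem dpow_zero (b : PsiDO) (n : ℤ) : dpow 0 b n = b.coeff n := by
  rw [dpow, finsum_eq_single _ 0]
  · simp
  · intro k hk
    simp [Ring.choose_zero_pos ℤ (Nat.pos_of_ne_zero hk)]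

theorem dpow_one (i n : ℤ) : dpow i 1 n = if n = i then 1 else 0 := by
  rw [dpow, finsum_eq_single _ 0]
  · simp [coeff_one, sub_eq_zero]
  · intro k hk
    obtain ⟨k, rfl⟩ := Nat.exists_eq_succ_of_ne_zero hk
    rw [coeff_one]
    split_ifs
    · simp [D_succ_one]
    · simp

/-- `∂ⁱ b` as an operator. -/
def dpowOp (i : ℤ) (b : PsiDO) : PsiDO :=
  ⟨dpow i b, by
    obtain ⟨B, hB⟩ := b.bounded
    exact ⟨B + i, fun n hn => dpow_eq_zero i b n hB hn⟩⟩

@[simp] theorem coeff_dpowOp (i : ℤ) (b : PsiDO) (n : ℤ) : (dpowOp i b).coeff n = dpow i b n := rfl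

theorem dpow_succ (i : ℤ) (b : PsiDO) (n : ℤ) :
    dpow (i + 1) b n = dpow i b (n - 1) + PowerSeries.derivative ℂ (dpow i b n) := by
  obtain ⟨B, hB⟩ := b.bounded
  obtain ⟨K, hK⟩ : ∃ K : ℕ, B + i - n + 1 < K := ⟨(B + i - n).toNat + 2, by push_cast; omega⟩
  have h1 : B + (i + 1) - n < (K + 1 : ℕ) := by push_cast; omega
  have h2 : B + i - (n - 1) < (K + 1 : ℕ) := by push_cast; omega
  have h3 : B + i - n < (K : ℕ) := by omega
  rw [dpow_eq_sum _ _ _ hB h1, dpow_eq_sum _ _ _ hB h2, dpow_eq_sum _ _ _ hB h3,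
    Finset.sum_range_succ' _ K, Finset.sum_range_succ' _ K, map_sum, add_right_comm,
    ← Finset.sum_add_distrib]
  congr 1
  · refine Finset.sum_congr rfl fun k _ => ?_
    rw [Ring.choose_succ_succ, add_smul, map_zsmul, D_succ,
      show n + ((k + 1 : ℕ) : ℤ) - (i + 1) = n + k - i by push_cast; ring,
      show n - 1 + ((k + 1 : ℕ) : ℤ) - i = n + k - i by push_cast; ring, D_succ, add_comm]
  · simp only [Ring.choose_zero_right, D_zero_left, Nat.cast_zero]
    congr 2; ring

theorem dpowOp_succ (i : ℤ) (b : PsiDO) : dpowOp (i + 1) b = dpowOp 1 (dpowOp i b) := by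
  ext1; funext n
  have := dpow_succ 0 (dpowOp i b) n
  rw [zero_add, dpow_zero, dpow_zero] at this
  simp only [coeff_dpowOp] at this ⊢
  rw [this, dpow_succ]

theorem dpowOp_zero (b : PsiDO) : dpowOp 0 b = b := by
  ext1; funext n; exact dpow_zero b n

theorem coeff_dpowOp_one (b : PsiDO) (n : ℤ) :
    (dpowOp 1 b).coeff n = b.coeff (n - 1) + PowerSeries.derivative ℂ (b.coeff n) := by
  have := dpow_succ 0 b n
  rwa [zero_add, dpow_zero, dpow_zero] at this

theorem dpowOp_one_injective : Function.Injective (dpowOp 1) := by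
  intro b c h
  obtain ⟨N, hb, hc⟩ := exists_bound b c
  have key : ∀ m : ℕ, b.coeff (N + 1 - m) = c.coeff (N + 1 - m) := by
    intro m
    induction m with
    | zero => rw [hb _ (by push_cast; omega), hc _ (by push_cast; omega)]
    | succ m ih =>
      have h1 := congrArg (fun a : PsiDO => a.coeff (N + 1 - m)) h
      simp only [coeff_dpowOp_one, ih] at h1
      have h2 := add_right_cancel h1
      have e : N + 1 - ((m + 1 : ℕ) : ℤ) = N + 1 - m - 1 := by push_cast; ring
      rw [e, h2]
  ext1; funext j
  by_cases hj : N < j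
  · rw [hb j hj, hc j hj]
  · have := key (N + 1 - j).toNat
    rwa [Int.toNat_of_nonneg (by omega), show N + 1 - (N + 1 - j) = j by ring] at this

theorem dpowOp_one_mul (b c : PsiDO) : dpowOp 1 b * c = dpowOp 1 (b * c) := by
  obtain ⟨N, hb, hc⟩ := exists_bound b c
  have hb1 : ∀ j, N + 1 < j → (dpowOp 1 b).coeff j = 0 :=
    fun j hj => dpow_eq_zero 1 b j hb (by omega)
  ext1; funext n
  rw [coeff_dpowOp_one, coeff_mul_eq_sum (lo := n - 1 - N) (hi := N + 1) _ c n hb1 hc (by omega)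
      (le_refl _),
    coeff_mul_eq_sum (lo := n - 1 - N - 1) (hi := N) b c (n - 1) hb hc (by omega) (le_refl _),
    coeff_mul_eq_sum (lo := n - 1 - N) (hi := N + 1) b c n hb hc (by omega) (by omega), map_sum]
  have e : ∑ i ∈ Finset.Icc (n - 1 - N - 1) N, b.coeff i * dpow (i + 1) c n
      = ∑ i ∈ Finset.Icc (n - 1 - N) (N + 1), b.coeff (i - 1) * dpow i c n := by
    refine Finset.sum_bij (fun i _ => i + 1) ?_ ?_ ?_ ?_
    · intro i hi; simp only [Finset.mem_Icc] at hi ⊢; omega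
    · intro i _ j _ h; omega
    · intro i hi
      exact ⟨i - 1, by simp only [Finset.mem_Icc] at hi ⊢; omega, by ring⟩
    · intro i _; simp
  have e2 : ∑ i ∈ Finset.Icc (n - 1 - N - 1) N, b.coeff i * PowerSeries.derivative ℂ (dpow i c n)
      = ∑ i ∈ Finset.Icc (n - 1 - N) (N + 1),
          b.coeff i * PowerSeries.derivative ℂ (dpow i c n) := by
    have hl : ∑ i ∈ Finset.Icc (n - 1 - N - 1) (N + 1),
        b.coeff i * PowerSeries.derivative ℂ (dpow i c n)
        = ∑ i ∈ Finset.Icc (n - 1 - N - 1) N,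
        b.coeff i * PowerSeries.derivative ℂ (dpow i c n) := by
      symm
      apply Finset.sum_subset
      · intro i; simp only [Finset.mem_Icc]; omega
      · intro i hi hi'
        simp only [Finset.mem_Icc] at hi hi'
        simp [hb i (by omega)]
    rw [← hl]
    symm
    apply Finset.sum_subset
    · intro i; simp only [Finset.mem_Icc]; omega
    · intro i hi hi'
      simp only [Finset.mem_Icc] at hi hi'
      simp [dpow_eq_zero i c n hc (by omega)]
  have e3 : ∑ i ∈ Finset.Icc (n - 1 - N - 1) N, b.coeff i * dpow i c (n - 1)
      = ∑ i ∈ Finset.Icc (n - 1 - N - 1) N, b.coeff i * dpow (i + 1) c n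
        - ∑ i ∈ Finset.Icc (n - 1 - N - 1) N,
          b.coeff i * PowerSeries.derivative ℂ (dpow i c n) := by
    rw [← Finset.sum_sub_distrib]
    exact Finset.sum_congr rfl fun i _ => by rw [dpow_succ]; ring
  rw [e3, e, e2, ← Finset.sum_sub_distrib, ← Finset.sum_add_distrib]
  refine Finset.sum_congr rfl fun i _ => ?_
  rw [coeff_dpowOp_one, Derivation.leibniz, smul_eq_mul, smul_eq_mul]
  ring

theorem dpowOp_mul (i : ℤ) (b c : PsiDO) : dpowOp i b * c = dpowOp i (b * c) := by
  induction i using Int.induction_on with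
  | zero => rw [dpowOp_zero, dpowOp_zero]
  | succ i ih => rw [dpowOp_succ, dpowOp_succ, dpowOp_one_mul, ih]
  | pred i ih =>
    apply dpowOp_one_injective
    rw [← dpowOp_one_mul, ← dpowOp_succ, ← dpowOp_succ, sub_add_cancel, ih]

theorem mul_assoc' (a b c : PsiDO) : a * b * c = a * (b * c) := by
  obtain ⟨A, hA⟩ := a.bounded
  obtain ⟨B, hB⟩ := b.bounded
  obtain ⟨C, hC⟩ := c.bounded
  have hab := coeff_mul_eq_zero a b hA hB
  have hbc := coeff_mul_eq_zero b c hB hC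
  ext1; funext n
  rw [coeff_mul_eq_sum (lo := n - C) (hi := A + B) _ c n hab hC (le_refl _) (le_refl _),
    coeff_mul_eq_sum (lo := n - (B + C)) (hi := A) a _ n hA hbc (le_refl _) (le_refl _)]
  have h1 : ∀ s ∈ Finset.Icc (n - C) (A + B), (a * b).coeff s * dpow s c n
      = ∑ i ∈ Finset.Icc (n - (B + C)) A, a.coeff i * (dpow i b s * dpow s c n) := by
    intro s hs
    simp only [Finset.mem_Icc] at hs
    rw [coeff_mul_eq_sum (lo := n - (B + C)) (hi := A) a b s hA hB (by omega) (le_refl _),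
      Finset.sum_mul]
    exact Finset.sum_congr rfl fun i _ => by ring
  have h2 : ∀ i ∈ Finset.Icc (n - (B + C)) A, a.coeff i * dpow i (b * c) n
      = ∑ s ∈ Finset.Icc (n - C) (A + B), a.coeff i * (dpow i b s * dpow s c n) := by
    intro i hi
    simp only [Finset.mem_Icc] at hi
    have hib : ∀ j, A + B < j → (dpowOp i b).coeff j = 0 :=
      fun j hj => dpow_eq_zero i b j hB (by omega)
    rw [← coeff_dpowOp, ← dpowOp_mul,
      coeff_mul_eq_sum (lo := n - C) (hi := A + B) _ c n hib hC (le_refl _) (le_refl _),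
      Finset.mul_sum]
    rfl
  rw [Finset.sum_congr rfl h1, Finset.sum_congr rfl h2, Finset.sum_comm]

theorem one_mul' (a : PsiDO) : 1 * a = a := by
  ext1; funext n
  rw [coeff_mul, finsum_eq_single _ 0]
  · simp [coeff_one, dpow_zero]
  · intro i hi
    simp [coeff_one, hi]

theorem mul_one' (a : PsiDO) : a * 1 = a := by
  ext1; funext n
  rw [coeff_mul, finsum_eq_single _ n]
  · simp [dpow_one]
  · intro i hi
    simp [dpow_one, hi.symm]

theorem mul_add' (a b c : PsiDO) : a * (b + c) = a * b + a * c := by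
  obtain ⟨A, hA⟩ := a.bounded
  obtain ⟨N, hb, hc⟩ := exists_bound b c
  have hbc : ∀ j, N < j → (b + c).coeff j = 0 := fun j hj => by simp [hb j hj, hc j hj]
  ext1; funext n
  rw [coeff_add, coeff_mul_eq_sum a _ n hA hbc (le_refl _) (le_refl _),
    coeff_mul_eq_sum a b n hA hb (le_refl _) (le_refl _),
    coeff_mul_eq_sum a c n hA hc (le_refl _) (le_refl _), ← Finset.sum_add_distrib]
  exact Finset.sum_congr rfl fun i _ => by rw [dpow_add, mul_add]

theorem add_mul' (a b c : PsiDO) : (a + b) * c = a * c + b * c := by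
  obtain ⟨C, hC⟩ := c.bounded
  obtain ⟨N, ha, hb⟩ := exists_bound a b
  have hab : ∀ j, N < j → (a + b).coeff j = 0 := fun j hj => by simp [ha j hj, hb j hj]
  ext1; funext n
  rw [coeff_add, coeff_mul_eq_sum _ c n hab hC (le_refl _) (le_refl _),
    coeff_mul_eq_sum a c n ha hC (le_refl _) (le_refl _),
    coeff_mul_eq_sum b c n hb hC (le_refl _) (le_refl _), ← Finset.sum_add_distrib]
  exact Finset.sum_congr rfl fun i _ => by rw [coeff_add, add_mul]

theorem smul_mul' (r : ℂ) (a b : PsiDO) : r • a * b = r • (a * b) := by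
  obtain ⟨N, ha, hb⟩ := exists_bound a b
  have hra : ∀ j, N < j → (r • a).coeff j = 0 := fun j hj => by simp [ha j hj]
  ext1; funext n
  rw [coeff_smul, coeff_mul_eq_sum _ b n hra hb (le_refl _) (le_refl _),
    coeff_mul_eq_sum a b n ha hb (le_refl _) (le_refl _), Finset.smul_sum]
  exact Finset.sum_congr rfl fun i _ => by rw [coeff_smul, smul_mul_assoc]

theorem mul_smul' (r : ℂ) (a b : PsiDO) : a * r • b = r • (a * b) := by
  obtain ⟨N, ha, hb⟩ := exists_bound a b
  have hrb : ∀ j, N < j → (r • b).coeff j = 0 := fun j hj => by simp [hb j hj]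
  ext1; funext n
  rw [coeff_smul, coeff_mul_eq_sum a _ n ha hrb (le_refl _) (le_refl _),
    coeff_mul_eq_sum a b n ha hb (le_refl _) (le_refl _), Finset.smul_sum]
  exact Finset.sum_congr rfl fun i _ => by rw [dpow_smul, mul_smul_comm]

/-- The ring of pseudodifferential operators. -/
instance : Ring PsiDO :=
  { (inferInstance : AddCommGroup PsiDO) with
    mul := (· * ·)
    one := 1
    mul_assoc := mul_assoc'
    one_mul := one_mul'
    mul_one := mul_one'
    left_distrib := mul_add'
    right_distrib := add_mul'
    zero_mul := fun a => by simpa using add_mul' 0 0 a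
    mul_zero := fun a => by simpa using mul_add' a 0 0 }

instance : Algebra ℂ PsiDO := Algebra.ofModule smul_mul' mul_smul'

end PsiDO

/-- A differential operator: no negative powers of `∂` occur. -/
def IsDifferential (P : PsiDO) : Prop := ∀ j : ℤ, j < 0 → P.coeff j = 0

/-- A fractional differential operator (with coefficients in `ℂ⟦x⟧`): `L = P Q⁻¹` for differential
operators `P` and `Q ≠ 0`. Since the leading coefficient of `Q` need not be a unit of `ℂ⟦x⟧`, the
quotient is taken in the skew field of fractions, that is, `L Q = P`. -/
def IsFractional (L : PsiDO) : Prop :=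
  ∃ P Q : PsiDO, IsDifferential P ∧ IsDifferential Q ∧ Q ≠ 0 ∧ L * Q = P

/-- `L` is in normalized form of order `m`: `L = ∂ᵐ + 0 · ∂ᵐ⁻¹ + (lower order terms)`. -/
def IsNormalized (L : PsiDO) (m : ℤ) : Prop :=
  L.coeff m = 1 ∧ L.coeff (m - 1) = 0 ∧ ∀ j : ℤ, m < j → L.coeff j = 0

/-- Operators of the form `U = 1 + ∑_{j ≥ 1} uⱼ(x) ∂⁻ʲ`. -/
def IsMonicOrderZero (U : PsiDO) : Prop :=
  U.coeff 0 = 1 ∧ ∀ j : ℤ, 0 < j → U.coeff j = 0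

/-! ### Sato's Grassmannian -/

/-- The field `𝕃 = ℂ((z⁻¹))`. The variable of the Laurent series is `z⁻¹`, so that the
coefficient of `zʲ` in `f` is `zcoeff f j`. -/
def LL : Type := LaurentSeries ℂ

instance : Field LL := inferInstanceAs (Field (LaurentSeries ℂ))

instance : Algebra ℂ LL := (HahnSeries.instAlgebra : Algebra ℂ (HahnSeries ℤ ℂ))

/-- The coefficient of `zʲ` in `f ∈ ℂ((z⁻¹))`. -/
def zcoeff (f : LL) (j : ℤ) : ℂ := HahnSeries.coeff (Γ := ℤ) (R := ℂ) f (-j)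

theorem zcoeff_algebraMap (c : ℂ) (j : ℤ) :
    zcoeff (algebraMap ℂ LL c) j = if j = 0 then c else 0 := by
  have h : zcoeff (algebraMap ℂ LL c) j = HahnSeries.coeff (HahnSeries.C c : LaurentSeries ℂ) (-j) :=
    rfl
  rw [h, HahnSeries.C_apply, HahnSeries.coeff_single]
  simp only [neg_eq_zero]

theorem zcoeff_zero (j : ℤ) : zcoeff 0 j = 0 := rfl

theorem zcoeff_add (f g : LL) (j : ℤ) : zcoeff (f + g) j = zcoeff f j + zcoeff g j := rfl

theorem zcoeff_smul (c : ℂ) (f : LL) (j : ℤ) : zcoeff (c • f) j = c * zcoeff f j := rfl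

theorem LL.ext {f g : LL} (h : ∀ j, zcoeff f j = zcoeff g j) : f = g :=
  HahnSeries.ext (funext fun n => by simpa [zcoeff] using h (-n))

/-- `𝕃₊ = ℂ[z]`. -/
def Lplus : Submodule ℂ LL where
  carrier := {f | ∀ j : ℤ, j < 0 → zcoeff f j = 0}
  zero_mem' := fun _ _ => rfl
  add_mem' := fun {f g} hf hg j hj => by rw [zcoeff_add, hf j hj, hg j hj, add_zero]
  smul_mem' := fun c f hf j hj => by rw [zcoeff_smul, hf j hj, mul_zero]

/-- The series obtained from `f` by keeping only the powers `zʲ` with `j ≥ 0`, that is, the powers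
of `z⁻¹` with exponent less than `1`. -/
def truncPlus (f : LL) : LL := HahnSeries.truncLT (Γ := ℤ) (R := ℂ) 1 f

theorem zcoeff_truncPlus (f : LL) (j : ℤ) :
    zcoeff (truncPlus f) j = if 0 ≤ j then zcoeff f j else 0 := by
  refine (HahnSeries.coeff_truncLT (Γ := ℤ) (R := ℂ) 1 f (-j)).trans ?_
  have h : (-j < (1 : ℤ)) ↔ 0 ≤ j := by omega
  simp only [h]
  rfl

/-- The projection `π₊ : 𝕃 = 𝕃₊ ⊕ 𝕃₋ → 𝕃₊`, where `𝕃₋ = z⁻¹ℂ⟦z⁻¹⟧`. -/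
def piPlus : LL →ₗ[ℂ] Lplus where
  toFun f := ⟨truncPlus f, fun j hj => by rw [zcoeff_truncPlus, if_neg (by omega)]⟩
  map_add' f g := Subtype.ext (LL.ext fun j => by
    simp only [zcoeff_truncPlus, zcoeff_add, Submodule.coe_add]
    split_ifs <;> simp)
  map_smul' c f := Subtype.ext (LL.ext fun j => by
    simp only [zcoeff_truncPlus, zcoeff_smul, Submodule.coe_smul, RingHom.id_apply]
    split_ifs <;> simp)

/-- The big cell `Gr₊(0)`: the subspaces `W ⊆ 𝕃` such that `π₊` restricts to an isomorphism
`W ≅ 𝕃₊`. -/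
def BigCell : Set (Submodule ℂ LL) :=
  {W | Function.Bijective (piPlus.domRestrict W)}

/-- The constants `ℂ ⊆ 𝕃`. -/
def constants : Set LL := Set.range (algebraMap ℂ LL)

/-- The spectral field `K_W = {f ∈ 𝕃 : dim (W + f W)/W < ∞}`, as a set. -/
def spectralField (W : Submodule ℂ LL) : Set LL :=
  {f | FiniteDimensional ℂ
    (↥(W ⊔ W.map (LinearMap.mulLeft ℂ f)) ⧸
      W.submoduleOf (W ⊔ W.map (LinearMap.mulLeft ℂ f)))}

/-! ### The action of pseudodifferential operators on `𝕃` -/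

/-- The operator `f(∂) = ∑ⱼ fⱼ ∂ʲ` with constant coefficients attached to `f = ∑ⱼ fⱼ zʲ`. -/
def constOp (f : LL) : PsiDO :=
  ⟨fun j => PowerSeries.C (zcoeff f j), by
    refine ⟨-HahnSeries.order (Γ := ℤ) (R := ℂ) f, fun j hj => ?_⟩
    have h : zcoeff f j = 0 :=
      HahnSeries.coeff_eq_zero_of_lt_order (Γ := ℤ) (R := ℂ) (x := f) (by omega)
    rw [h, map_zero]⟩

/-- The class of `∑ⱼ uⱼ(x) ∂ʲ` in `𝒫 / x𝒫 ≅ 𝕃`, where `∂ʲ` corresponds to `zʲ`: the series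
`∑ⱼ uⱼ(0) zʲ`. -/
def atZero (L : PsiDO) : LL :=
  HahnSeries.ofSuppBddBelow (fun n : ℤ => PowerSeries.constantCoeff (L.coeff (-n))) (by
    obtain ⟨N, hN⟩ := L.bounded
    refine ⟨-N, fun n hn => ?_⟩
    by_contra h
    exact hn (by simp [hN (-n) (by omega)]))

/-- The right action of `𝒫` on `𝕃 ≅ 𝒫 / x𝒫`: the class of `v(∂)` is sent to the class of
`v(∂) L`. -/
def act (v : LL) (L : PsiDO) : LL := atZero (constOp v * L)

/-- The set `𝒦_W = {U f(∂) U⁻¹ : f ∈ K_W}` of operators. -/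
def spectralOps (W : Submodule ℂ LL) (U : PsiDO) : Set PsiDO :=
  {L | ∃ f ∈ spectralField W, L = U * constOp f * Ring.inverse U}

/-- A commutative (unital) algebra of fractional differential operators. -/
def IsCommFractionalAlgebra (A : Subalgebra ℂ PsiDO) : Prop :=
  (∀ L ∈ A, IsFractional L) ∧ ∀ L ∈ A, ∀ M ∈ A, L * M = M * L

/-- A commutative algebra of fractional differential operators that is maximal, with respect to
inclusion, among all such algebras. -/
def IsMaximalCommFractionalAlgebra (A : Subalgebra ℂ PsiDO) : Prop :=
  Maximal IsCommFractionalAlgebra A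

end SatoFractional

end

open SatoFractional

noncomputable section

namespace SatoFractional

open PsiDO

/-! ### Orders of operators -/

/-! The bridge between operators and subspaces is `isFractional_iff`: `L` is fractional exactly when
it maps `𝕃₊` into `𝕃₊` up to finite dimension. If `L Q = P`, then `𝕃₊ · L` lies in the preimage of
`𝕃₊` under `Q`, and this preimage exceeds `𝕃₊` by finitely many dimensions only, because a nonzero
`Q` acts injectively on series of sufficiently negative order (`exists_weight`,
`almostLE_comap_actHom`). Conversely, if `𝕃₊ · L` lies in `𝕃₊ + F` with `F` finite-dimensional, some
nonzero differential `Q` sends `F` into `𝕃₊` (`exists_annihilator`); then `L Q` preserves `𝕃₊` and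
is therefore differential (`isDifferential_of_act_mem`).

Transporting this criterion along `U` shows that `U f(∂) U⁻¹` is fractional iff `f ∈ K_W` for `W =
𝕃₊ · U`. Maximality follows from the centralizer computation `eq_constOp_of_commute`: whatever
commutes with a nonconstant `f(∂)` has constant coefficients. So a commutative fractional algebra
containing one `U f(∂) U⁻¹` with `f` nonconstant is contained in `𝒦_W`.

For the second half, a normalized operator of order `m ≠ 0` is `U ∂ᵐ U⁻¹` for some monic `U` of
order zero (`IsNormalized.exists_conj`). The same containment and maximality give equality with
`𝒦_W`, and unipotence of the action of `U` puts `𝕃₊ · U` in the big cell. -/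

/-- The operator has order at most `N`. -/
def OrderLE (a : PsiDO) (N : ℤ) : Prop := ∀ j, N < j → a.coeff j = 0

theorem exists_orderLE (a : PsiDO) : ∃ N, OrderLE a N := a.bounded

namespace OrderLE

variable {a b : PsiDO} {A B N : ℤ}

theorem mono (h : OrderLE a A) (hAB : A ≤ B) : OrderLE a B := fun j hj => h j (by omega)

theorem add (ha : OrderLE a N) (hb : OrderLE b N) : OrderLE (a + b) N := fun j hj => by
  rw [coeff_add, ha j hj, hb j hj, add_zero]

theorem neg (ha : OrderLE a N) : OrderLE (-a) N := fun j hj => by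
  change -a.coeff j = 0
  rw [ha j hj, neg_zero]

theorem sub (ha : OrderLE a N) (hb : OrderLE b N) : OrderLE (a - b) N := by
  rw [sub_eq_add_neg]; exact ha.add hb.neg

theorem mul (ha : OrderLE a A) (hb : OrderLE b B) : OrderLE (a * b) (A + B) :=
  coeff_mul_eq_zero a b ha hb

theorem pred (ha : OrderLE a N) (h : a.coeff N = 0) : OrderLE a (N - 1) := fun j hj => by
  rcases eq_or_ne j N with rfl | hne
  · exact h
  · exact ha j (by omega)

end OrderLE

theorem PsiDO.coeff_sub (a b : PsiDO) (j : ℤ) : (a - b).coeff j = a.coeff j - b.coeff j := rfl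

theorem orderLE_monomial (m : ℤ) (u : ℂ⟦X⟧) : OrderLE (monomial m u) m := fun j hj => by
  simp [hj.ne']

theorem eq_zero_of_forall_orderLE {a : PsiDO} (h : ∀ n : ℕ, OrderLE a (-n)) : a = 0 := by
  ext1; funext j
  exact h (-j + 1).toNat j (by omega)

theorem exists_leading {a : PsiDO} (ha : a ≠ 0) : ∃ N, OrderLE a N ∧ a.coeff N ≠ 0 := by
  have hne : ∃ j, a.coeff j ≠ 0 := by
    by_contra! h
    exact ha (PsiDO.ext (funext h))
  obtain ⟨B, hB⟩ := exists_orderLE a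
  obtain ⟨N, hN, hmax⟩ := Int.exists_greatest_of_bdd (P := fun j => a.coeff j ≠ 0)
    ⟨B, fun j hj => by by_contra h; exact hj (hB j (by omega))⟩ hne
  exact ⟨N, fun j hj => by by_contra h; exact absurd (hmax j h) (by omega), hN⟩

/-- The leading coefficient of `∂ⁱ b`. -/
theorem dpow_top {b : PsiDO} {B : ℤ} (hb : OrderLE b B) (i : ℤ) :
    dpow i b (i + B) = b.coeff B := by
  rw [dpow_eq_sum i b _ hb (K := 1) (by push_cast; omega)]
  simp

/-- The subleading coefficient of `∂ⁱ b`. -/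
theorem dpow_top_pred {b : PsiDO} {B : ℤ} (hb : OrderLE b B) (i : ℤ) :
    dpow i b (i + B - 1) = b.coeff (B - 1) + i • PowerSeries.derivative ℂ (b.coeff B) := by
  rw [dpow_eq_sum i b _ hb (K := 2) (by push_cast; omega)]
  simp only [Finset.sum_range_succ, Finset.sum_range_zero, Ring.choose_zero_right,
    Ring.choose_one_right, D_zero_left, D_succ, zero_add, one_smul]
  rw [show i + B - 1 + ((0 : ℕ) : ℤ) - i = B - 1 by push_cast; ring,
    show i + B - 1 + ((1 : ℕ) : ℤ) - i = B by push_cast; ring]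

theorem coeff_mul_top {a b : PsiDO} {A B : ℤ} (ha : OrderLE a A) (hb : OrderLE b B) :
    (a * b).coeff (A + B) = a.coeff A * b.coeff B := by
  rw [coeff_mul_eq_sum a b _ ha hb (lo := A) (hi := A) (by omega) le_rfl]
  simp [dpow_top hb]

theorem coeff_mul_top_pred {a b : PsiDO} {A B : ℤ} (ha : OrderLE a A) (hb : OrderLE b B) :
    (a * b).coeff (A + B - 1) = a.coeff A * b.coeff (B - 1) + a.coeff (A - 1) * b.coeff B
      + A • (a.coeff A * PowerSeries.derivative ℂ (b.coeff B)) := by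
  rw [coeff_mul_eq_sum a b _ ha hb (lo := A - 1) (hi := A) (by omega) le_rfl,
    show Finset.Icc (A - 1) A = {A - 1, A} by ext; simp; omega,
    Finset.sum_pair (by omega), dpow_top_pred hb, show A + B - 1 = (A - 1) + B by ring,
    dpow_top hb, mul_add, mul_smul_comm]
  ring

/-- Leading coefficients multiply, and `ℂ⟦X⟧` is a domain. -/
instance : NoZeroDivisors PsiDO where
  eq_zero_or_eq_zero_of_mul_eq_zero {a b} h := by
    by_contra! hab
    obtain ⟨A, hA, hA'⟩ := exists_leading hab.1
    obtain ⟨B, hB, hB'⟩ := exists_leading hab.2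
    have := coeff_mul_top hA hB
    rw [h, coeff_zero] at this
    exact mul_ne_zero hA' hB' this.symm

/-! ### Constant coefficients and the action on `𝕃` -/

theorem zcoeff_neg (f : LL) (j : ℤ) : zcoeff (-f) j = -zcoeff f j := rfl

theorem zcoeff_sub (f g : LL) (j : ℤ) : zcoeff (f - g) j = zcoeff f j - zcoeff g j := by
  rw [sub_eq_add_neg, zcoeff_add, zcoeff_neg, sub_eq_add_neg]

@[simp] theorem coeff_constOp (f : LL) (j : ℤ) :
    (constOp f).coeff j = PowerSeries.C (zcoeff f j) := rfl

@[simp] theorem zcoeff_atZero (L : PsiDO) (j : ℤ) :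
    zcoeff (atZero L) j = PowerSeries.constantCoeff (L.coeff j) := by
  change PowerSeries.constantCoeff (L.coeff (- -j)) = _
  rw [neg_neg]

theorem exists_zcoeff_bound (f : LL) : ∃ N : ℤ, ∀ j, N < j → zcoeff f j = 0 := by
  obtain ⟨N, hN⟩ := exists_orderLE (constOp f)
  exact ⟨N, fun j hj => by simpa using hN j hj⟩

theorem orderLE_constOp {f : LL} {N : ℤ} (h : ∀ j, N < j → zcoeff f j = 0) :
    OrderLE (constOp f) N := fun j hj => by simp [h j hj]

theorem atZero_constOp (f : LL) : atZero (constOp f) = f := LL.ext fun j => by simp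

theorem constOp_injective : Function.Injective constOp :=
  Function.LeftInverse.injective atZero_constOp

theorem D_succ_C (k : ℕ) (c : ℂ) : D (k + 1) (PowerSeries.C c) = 0 := by
  induction k with
  | zero => simp [D_succ]
  | succ k ih => rw [D_succ, ih, map_zero]

theorem dpow_constOp (i : ℤ) (f : LL) (n : ℤ) :
    dpow i (constOp f) n = PowerSeries.C (zcoeff f (n - i)) := by
  rw [dpow, finsum_eq_single _ 0]
  · simp
  · intro k hk
    obtain ⟨k, rfl⟩ := Nat.exists_eq_succ_of_ne_zero hk
    rw [coeff_constOp, D_succ_C, smul_zero]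

theorem zcoeff_mul (f g : LL) (n : ℤ) {A B : ℤ} (hA : ∀ j, A < j → zcoeff f j = 0)
    (hB : ∀ j, B < j → zcoeff g j = 0) :
    zcoeff (f * g) n = ∑ i ∈ Finset.Icc (n - B) A, zcoeff f i * zcoeff g (n - i) := by
  refine (HahnSeries.coeff_mul (Γ := ℤ) (R := ℂ)).trans ?_
  -- Hahn series exponents are powers of `z⁻¹`, hence the sign.
  refine Finset.sum_bij_ne_zero (fun ij _ _ => -ij.1) ?_ ?_ ?_ ?_
  · intro ij hij _
    rw [Finset.mem_antidiagonal] at hij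
    have h1 := hA (-ij.1)
    have h2 := hB (-ij.2)
    simp only [zcoeff, neg_neg] at h1 h2
    rw [Finset.mem_Icc]
    have h1' := mt h1 hij.1
    have h2' := mt h2 hij.2.1
    have := hij.2.2
    omega
  · intro a ha _ b hb _ hab
    rw [Finset.mem_antidiagonal] at ha hb
    have h1 := ha.2.2
    have h2 := hb.2.2
    exact Prod.ext (by omega) (by omega)
  · intro i _ hi
    refine ⟨(-i, -(n - i)), ?_, hi, by simp⟩
    rw [Finset.mem_antidiagonal]
    exact ⟨left_ne_zero_of_mul hi, right_ne_zero_of_mul hi, by ring⟩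
  · intro ij hij _
    rw [Finset.mem_antidiagonal] at hij
    have := hij.2.2
    simp only [zcoeff, neg_neg]
    congr 2
    omega

theorem constOp_mul (f g : LL) : constOp (f * g) = constOp f * constOp g := by
  obtain ⟨A, hA⟩ := exists_zcoeff_bound f
  obtain ⟨B, hB⟩ := exists_zcoeff_bound g
  ext1; funext n
  rw [coeff_mul_eq_sum _ _ n (orderLE_constOp hA) (orderLE_constOp hB) le_rfl le_rfl,
    coeff_constOp, zcoeff_mul f g n hA hB, map_sum]
  exact Finset.sum_congr rfl fun i _ => by rw [dpow_constOp, coeff_constOp, map_mul]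

theorem constOp_algebraMap (c : ℂ) : constOp (algebraMap ℂ LL c) = algebraMap ℂ PsiDO c := by
  ext1; funext j
  rw [Algebra.algebraMap_eq_smul_one (A := PsiDO), coeff_smul, coeff_constOp, zcoeff_algebraMap,
    PsiDO.coeff_one]
  split_ifs
  · rw [PowerSeries.smul_eq_C_mul, mul_one]
  · simp

/-- `f ↦ f(∂)` as an algebra homomorphism. -/
def constOpHom : LL →ₐ[ℂ] PsiDO where
  toFun := constOp
  map_one' := by
    have := constOp_algebraMap 1
    rwa [map_one, map_one] at this
  map_mul' := constOp_mul
  map_zero' := PsiDO.ext (funext fun j => by simp [zcoeff_zero])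
  map_add' f g := PsiDO.ext (funext fun j => by simp [zcoeff_add])
  commutes' := constOp_algebraMap

@[simp] theorem constOpHom_apply (f : LL) : constOpHom f = constOp f := rfl

theorem constOp_comm (f g : LL) : constOp f * constOp g = constOp g * constOp f := by
  rw [← constOp_mul, mul_comm, constOp_mul]

theorem zcoeff_act (v : LL) (L : PsiDO) (n : ℤ) {A B lo hi : ℤ}
    (hA : ∀ j, A < j → zcoeff v j = 0) (hB : OrderLE L B) (hlo : lo ≤ n - B) (hhi : A ≤ hi) :
    zcoeff (act v L) n = ∑ i ∈ Finset.Icc lo hi,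
      zcoeff v i * PowerSeries.constantCoeff (dpow i L n) := by
  rw [act, zcoeff_atZero, coeff_mul_eq_sum _ _ n (orderLE_constOp hA) hB hlo hhi, map_sum]
  exact Finset.sum_congr rfl fun i _ => by simp

/-- `x𝒫` is a right ideal: the coefficients of `a` enter a product only as left factors, so setting
`x = 0` loses nothing but their higher Taylor coefficients. This is what makes `act` a right action.
-/
theorem atZero_mul (a M : PsiDO) : atZero (a * M) = act (atZero a) M := by
  obtain ⟨A, hA⟩ := exists_orderLE a
  obtain ⟨B, hB⟩ := exists_orderLE M
  refine LL.ext fun n => ?_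
  rw [zcoeff_act (atZero a) M n (fun j hj => by rw [zcoeff_atZero, hA j hj, map_zero]) hB le_rfl
    le_rfl, zcoeff_atZero, coeff_mul_eq_sum _ _ n hA hB le_rfl le_rfl, map_sum]
  exact Finset.sum_congr rfl fun i _ => by simp

theorem act_mul (v : LL) (L M : PsiDO) : act v (L * M) = act (act v L) M := by
  rw [act, ← mul_assoc, atZero_mul, ← act]

theorem act_constOp (v f : LL) : act v (constOp f) = v * f := by
  rw [act, ← constOp_mul, atZero_constOp]

theorem act_one (v : LL) : act v 1 = v := by
  rw [act, mul_one, atZero_constOp]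

theorem act_add (v : LL) (L M : PsiDO) : act v (L + M) = act v L + act v M := by
  refine LL.ext fun j => ?_
  rw [zcoeff_add]
  simp only [act, zcoeff_atZero, mul_add, PsiDO.coeff_add, map_add]

/-- The right action of an operator as a linear map. -/
def actHom (L : PsiDO) : LL →ₗ[ℂ] LL where
  toFun v := act v L
  map_add' v w := LL.ext fun j => by
    rw [zcoeff_add]
    simp only [act, zcoeff_atZero, ← constOpHom_apply, map_add, add_mul, PsiDO.coeff_add]
  map_smul' c v := LL.ext fun j => by
    rw [RingHom.id_apply, zcoeff_smul]
    simp only [act, zcoeff_atZero, ← constOpHom_apply, map_smul, smul_mul_assoc,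
      PsiDO.coeff_smul, PowerSeries.smul_eq_C_mul, map_mul, PowerSeries.constantCoeff_C]

@[simp] theorem actHom_apply (L : PsiDO) (v : LL) : actHom L v = act v L := rfl

theorem actHom_mul (L M : PsiDO) : actHom (L * M) = actHom M ∘ₗ actHom L :=
  LinearMap.ext fun v => act_mul v L M

/-- The power `zⁿ`. -/
def zpow (n : ℤ) : LL := (HahnSeries.single (-n) (1 : ℂ) : LaurentSeries ℂ)

theorem zcoeff_zpow (n j : ℤ) : zcoeff (zpow n) j = if j = n then 1 else 0 := by
  refine (HahnSeries.coeff_single (Γ := ℤ) (R := ℂ)).trans ?_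
  simp only [neg_inj]

theorem constOp_zpow (n : ℤ) : constOp (zpow n) = monomial n 1 := by
  ext1; funext j
  rw [coeff_constOp, zcoeff_zpow, coeff_monomial]
  split_ifs <;> simp

theorem zcoeff_zpow_act (i : ℤ) (L : PsiDO) (n : ℤ) :
    zcoeff (act (zpow i) L) n = PowerSeries.constantCoeff (dpow i L n) := by
  obtain ⟨B, hB⟩ := exists_orderLE L
  rw [zcoeff_act (zpow i) L n (A := i) (fun j hj => by rw [zcoeff_zpow, if_neg (by omega)]) hB
    (lo := min i (n - B)) (min_le_right _ _) le_rfl, Finset.sum_eq_single i]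
  · simp [zcoeff_zpow]
  · intro j _ hj; simp [zcoeff_zpow, hj]
  · intro h; simp at h

/-! ### Differential operators -/

/-- In each term either `k > i` and the binomial coefficient vanishes, or `n + k - i < 0` and the
coefficient of `P` does. -/
theorem dpow_eq_zero_of_isDifferential {P : PsiDO} (hP : IsDifferential P) (i : ℕ) {n : ℤ}
    (hn : n < 0) :
    dpow i P n = 0 := by
  refine finsum_eq_zero_of_forall_eq_zero fun k => ?_
  by_cases hk : i < k
  · rw [Ring.choose_natCast, Nat.choose_eq_zero_of_lt hk]; simp
  · rw [hP _ (by omega)]; simp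

theorem IsDifferential.mul {P Q : PsiDO} (hP : IsDifferential P) (hQ : IsDifferential Q) :
    IsDifferential (P * Q) := fun n hn => by
  rw [coeff_mul]
  refine finsum_eq_zero_of_forall_eq_zero fun i => ?_
  rcases lt_or_ge i 0 with hi | hi
  · rw [hP i hi, zero_mul]
  · lift i to ℕ using hi
    rw [dpow_eq_zero_of_isDifferential hQ i hn, mul_zero]

theorem act_mem_Lplus {P : PsiDO} (hP : IsDifferential P) {v : LL} (hv : v ∈ Lplus) :
    act v P ∈ Lplus := fun j hj => by
  have h : IsDifferential (constOp v) := fun i hi => by simp [hv i hi]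
  rw [act, zcoeff_atZero, h.mul hP j hj, map_zero]

theorem constantCoeff_D (k : ℕ) (u : ℂ⟦X⟧) :
    PowerSeries.constantCoeff (D k u) = k.factorial * PowerSeries.coeff k u := by
  rw [D, PowerSeries.constantCoeff_iterate_derivative]

theorem constantCoeff_dpow (i : ℤ) (b : PsiDO) (n : ℤ) {B : ℤ} (hB : OrderLE b B) {K : ℕ}
    (hK : B + i - n < K) :
    PowerSeries.constantCoeff (dpow i b n) = ∑ k ∈ Finset.range K,
      (Ring.choose i k : ℤ) * (k.factorial * PowerSeries.coeff k (b.coeff (n + k - i))) := by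
  rw [dpow_eq_sum i b n hB hK, map_sum]
  refine Finset.sum_congr rfl fun k _ => ?_
  rw [map_zsmul, constantCoeff_D, zsmul_eq_mul]

/-- The images of `1, z, z², …` determine the Taylor coefficients of all coefficients of `P` by a
triangular system, so those of negative index vanish one Taylor order at a time. -/
theorem isDifferential_of_act_mem {P : PsiDO} (h : ∀ v ∈ Lplus, act v P ∈ Lplus) :
    IsDifferential P := by
  obtain ⟨B, hB⟩ := exists_orderLE P
  have key : ∀ n : ℕ, ∀ j : ℤ, j < 0 → PowerSeries.coeff n (P.coeff j) = 0 := by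
    intro n
    induction n using Nat.strong_induction_on with
    | _ n ih =>
      intro j hj
      have h0 := h (zpow n) (fun i hi => by rw [zcoeff_zpow, if_neg (by omega)]) j hj
      rw [zcoeff_zpow_act, constantCoeff_dpow n P j hB
        (K := (B + n - j).toNat + n + 1) (by push_cast; omega),
        Finset.sum_eq_single n] at h0
      · rw [Ring.choose_natCast, Nat.choose_self, show j + (n : ℤ) - n = j by ring] at h0
        simpa [Nat.factorial_ne_zero] using h0
      · intro k _ hk
        rcases lt_or_gt_of_ne hk with hk | hk
        · rw [ih k hk _ (by omega)]; simp
        · rw [Ring.choose_natCast, Nat.choose_eq_zero_of_lt hk]; simp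
      · intro h; simp at h
  exact fun j hj => PowerSeries.ext fun n => by rw [key n j hj, map_zero]

/-! ### Subspaces contained in one another up to finite dimension -/

section AlmostLE

variable {V V' : Type*} [AddCommGroup V] [Module ℂ V] [AddCommGroup V'] [Module ℂ V']

/-- `A` is contained in `W` up to a finite-dimensional subspace. -/
def AlmostLE (A W : Submodule ℂ V) : Prop :=
  ∃ F : Submodule ℂ V, FiniteDimensional ℂ F ∧ A ≤ W ⊔ F

theorem AlmostLE.of_le {A W : Submodule ℂ V} (h : A ≤ W) : AlmostLE A W :=
  ⟨⊥, inferInstance, by simpa using h⟩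

theorem AlmostLE.trans {A B C : Submodule ℂ V} (h : AlmostLE A B) (h' : AlmostLE B C) :
    AlmostLE A C := by
  obtain ⟨F, hF, hAF⟩ := h
  obtain ⟨G, hG, hBG⟩ := h'
  exact ⟨G ⊔ F, inferInstance, hAF.trans (by rw [← sup_assoc]; exact sup_le_sup_right hBG F)⟩

theorem AlmostLE.map {A B : Submodule ℂ V} (h : AlmostLE A B) (φ : V →ₗ[ℂ] V') :
    AlmostLE (A.map φ) (B.map φ) := by
  obtain ⟨F, hF, hAF⟩ := h
  exact ⟨F.map φ, inferInstance, by rw [← Submodule.map_sup]; exact Submodule.map_mono hAF⟩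

theorem AlmostLE.sup {A B W : Submodule ℂ V} (h : AlmostLE A W) (h' : AlmostLE B W) :
    AlmostLE (A ⊔ B) W := by
  obtain ⟨F, hF, hAF⟩ := h
  obtain ⟨G, hG, hBG⟩ := h'
  exact ⟨F ⊔ G, inferInstance, sup_le (hAF.trans (sup_le_sup_left le_sup_left W))
    (hBG.trans (sup_le_sup_left le_sup_right W))⟩

/-- Both sides say that the image of `A` in `V ⧸ W` is finite-dimensional. The right side is a
transitive relation compatible with linear maps, which is the form used for `K_W` from here on. -/
theorem finiteDimensional_quotient_iff_almostLE (A W : Submodule ℂ V) :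
    FiniteDimensional ℂ (↥(W ⊔ A) ⧸ W.submoduleOf (W ⊔ A)) ↔ AlmostLE A W := by
  have hker : LinearMap.ker (W.mkQ ∘ₗ (W ⊔ A).subtype) = W.submoduleOf (W ⊔ A) := by
    rw [LinearMap.ker_comp, Submodule.ker_mkQ]; rfl
  have hrange : LinearMap.range (W.mkQ ∘ₗ (W ⊔ A).subtype) = A.map W.mkQ := by
    rw [LinearMap.range_comp, Submodule.range_subtype, Submodule.map_sup, Submodule.mkQ_map_self,
      bot_sup_eq]
  have e : (↥(W ⊔ A) ⧸ W.submoduleOf (W ⊔ A)) ≃ₗ[ℂ] A.map W.mkQ :=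
    (Submodule.quotEquivOfEq _ _ hker.symm).trans
      ((LinearMap.quotKerEquivRange _).trans (LinearEquiv.ofEq _ _ hrange))
  constructor
  · intro h
    have : FiniteDimensional ℂ (A.map W.mkQ) := e.finiteDimensional
    -- A linear section of `V → V ⧸ W` lifts the finite-dimensional image to the required
    -- complement.
    obtain ⟨σ, hσ⟩ := W.mkQ.exists_rightInverse_of_surjective W.range_mkQ
    refine ⟨(A.map W.mkQ).map σ, inferInstance, fun a ha => ?_⟩
    rw [← sub_add_cancel a (σ (W.mkQ a))]
    refine Submodule.add_mem_sup ?_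
      (Submodule.mem_map_of_mem (Submodule.mem_map_of_mem ha))
    rw [← Submodule.Quotient.mk_eq_zero, ← Submodule.mkQ_apply, map_sub,
      ← LinearMap.comp_apply W.mkQ σ, hσ, LinearMap.id_apply, sub_self]
  · rintro ⟨F, hF, hAF⟩
    have hle : A.map W.mkQ ≤ F.map W.mkQ := by
      refine (Submodule.map_mono hAF).trans ?_
      rw [Submodule.map_sup, Submodule.mkQ_map_self, bot_sup_eq]
    have : FiniteDimensional ℂ (A.map W.mkQ) := Submodule.finiteDimensional_of_le hle
    exact e.symm.finiteDimensional

end AlmostLE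

theorem mem_spectralField_iff {W : Submodule ℂ LL} {f : LL} :
    f ∈ spectralField W ↔ AlmostLE (W.map (LinearMap.mulLeft ℂ f)) W :=
  finiteDimensional_quotient_iff_almostLE _ _

/-! ### Differential operators pulling back `𝕃₊` -/

/-- A nonzero operator sends `zⁱ` to `p(i) zⁱ⁺ʷ` plus lower order terms, for a fixed
nonzero polynomial `p`; hence it has the expected effect on series of very negative order. -/
theorem exists_weight {Q : PsiDO} (hQ0 : Q ≠ 0) :
    ∃ w M : ℤ, (∀ i s : ℤ, w < s → PowerSeries.constantCoeff (dpow i Q (i + s)) = 0) ∧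
      ∀ i : ℤ, i < M → PowerSeries.constantCoeff (dpow i Q (i + w)) ≠ 0 := by
  obtain ⟨d, hd⟩ := exists_orderLE Q
  -- Give `∂` weight `1` and `x` weight `-1`: `q s k` is the coefficient of `xᵏ ∂ˢ⁺ᵏ`, of weight
  -- `s`, and this term sends `zⁱ` to `i(i-1)⋯(i-k+1) zⁱ⁺ˢ`.
  set q : ℤ → ℕ → ℂ := fun s k => PowerSeries.coeff k (Q.coeff (s + k)) with hq
  have formula : ∀ i s : ℤ, ∀ K : ℕ, d - s < K →
      PowerSeries.constantCoeff (dpow i Q (i + s))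
        = ∑ k ∈ Finset.range K, (descPochhammer ℂ k).eval (i : ℂ) * q s k := by
    intro i s K hK
    rw [constantCoeff_dpow i Q (i + s) hd (K := K) (by omega)]
    refine Finset.sum_congr rfl fun k _ => ?_
    have h := Ring.descPochhammer_eq_factorial_smul_choose i k
    rw [← Polynomial.eval_eq_smeval, nsmul_eq_mul] at h
    rw [← descPochhammer_eval_cast, h, hq, show i + s + (k : ℤ) - i = s + k by ring]
    push_cast
    ring
  have hbdd : ∀ s, (∃ k, q s k ≠ 0) → s ≤ d := by
    rintro s ⟨k, hk⟩
    by_contra hs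
    exact hk (by simp [hq, hd (s + k) (by omega)])
  have hex : ∃ s, ∃ k, q s k ≠ 0 := by
    obtain ⟨N, -, hN⟩ := exists_leading hQ0
    obtain ⟨k, hk⟩ : ∃ k, PowerSeries.coeff k (Q.coeff N) ≠ 0 := by
      by_contra! h
      exact hN (PowerSeries.ext fun k => by rw [h k, map_zero])
    exact ⟨N - k, k, by simpa [hq] using hk⟩
  -- Weights are bounded above by the order, so there is a top weight `w`.
  obtain ⟨w, ⟨k₀, hk₀⟩, hmax⟩ := Int.exists_greatest_of_bdd ⟨d, hbdd⟩ hex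
  obtain ⟨K, hK⟩ : ∃ K : ℕ, d - w < K := ⟨(d - w).toNat + 1, by push_cast; omega⟩
  set p : Polynomial ℂ := ∑ k ∈ Finset.range K, descPochhammer ℂ k * Polynomial.C (q w k) with hp
  have hpe : ∀ i : ℤ, p.eval (i : ℂ) = PowerSeries.constantCoeff (dpow i Q (i + w)) := by
    intro i
    rw [formula i w K hK, hp, Polynomial.eval_finsetSum]
    simp
  -- Falling factorials are independent: evaluating at the natural number `k` kills those of degree
  -- above `k`, and induction removes those below.
  have hp0 : p ≠ 0 := by
    intro h0
    have hall : ∀ k, q w k = 0 := by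
      intro k
      induction k using Nat.strong_induction_on with
      | _ k ih =>
        have h := hpe k
        rw [h0, Polynomial.eval_zero, formula k w (K + k + 1) (by push_cast; omega),
          Finset.sum_eq_single k] at h
        · rw [Int.cast_natCast, descPochhammer_eval_eq_descFactorial, Nat.descFactorial_self] at h
          simpa [Nat.factorial_ne_zero] using h.symm
        · intro j _ hj
          rcases lt_or_gt_of_ne hj with hj | hj
          · rw [ih j hj, mul_zero]
          · rw [Int.cast_natCast, descPochhammer_eval_coe_nat_of_lt hj, zero_mul]
        · intro h; simp at h
    exact hk₀ (hall k₀)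
  have hfin : {i : ℤ | p.IsRoot (i : ℂ)}.Finite :=
    (Polynomial.finite_setOfPred_isRoot hp0).preimage Int.cast_injective.injOn
  obtain ⟨M, hM⟩ := hfin.bddBelow
  refine ⟨w, M, fun i s hs => ?_, fun i hi h => ?_⟩
  · rw [formula i s ((d - s).toNat + 1) (by push_cast; omega)]
    refine Finset.sum_eq_zero fun k _ => ?_
    have : q s k = 0 := by
      by_contra hne
      exact absurd (hmax s ⟨k, hne⟩) (by omega)
    rw [this, mul_zero]
  · exact absurd (hM (show p.IsRoot (i : ℂ) by rw [Polynomial.IsRoot, hpe i, h])) (by omega)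

theorem exists_top_zcoeff {v : LL} (hv : v ≠ 0) :
    ∃ j, zcoeff v j ≠ 0 ∧ ∀ i, j < i → zcoeff v i = 0 := by
  have h0 : constOp v ≠ 0 := fun h => hv (constOp_injective (h.trans (map_zero constOpHom).symm))
  obtain ⟨N, hN, hN'⟩ := exists_leading h0
  refine ⟨N, fun h => hN' (by rw [coeff_constOp, h, map_zero]), fun i hi => ?_⟩
  simpa using hN i hi

/-- The series of negative order. -/
def Lminus : Submodule ℂ LL where
  carrier := {f | ∀ j : ℤ, 0 ≤ j → zcoeff f j = 0}
  zero_mem' := fun _ _ => rfl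
  add_mem' := fun {f g} hf hg j hj => by rw [zcoeff_add, hf j hj, hg j hj, add_zero]
  smul_mem' := fun c f hf j hj => by rw [zcoeff_smul, hf j hj, mul_zero]

theorem sub_truncPlus_mem_Lminus (f : LL) : f - truncPlus f ∈ Lminus := fun j hj => by
  rw [zcoeff_sub, zcoeff_truncPlus, if_pos hj, sub_self]

/-- The coefficient functional of `zʲ`. -/
def zcoeffHom (j : ℤ) : LL →ₗ[ℂ] ℂ where
  toFun f := zcoeff f j
  map_add' f g := zcoeff_add f g j
  map_smul' c f := zcoeff_smul c f j

/-- Since `Q` preserves `𝕃₊`, polynomial parts can be split off, leaving elements of negative order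
sent into `𝕃₊`. Such an element is determined by finitely many coefficients, because a leading term
of very low degree would survive in negative degree. -/
theorem almostLE_comap_actHom {Q : PsiDO} (hQ : IsDifferential Q) (hQ0 : Q ≠ 0) :
    AlmostLE (Lplus.comap (actHom Q)) Lplus := by
  obtain ⟨w, M, hw, hM⟩ := exists_weight hQ0
  obtain ⟨B, hB⟩ := exists_orderLE Q
  -- Below degree `-m` the weight polynomial has no root and `zʲ` lands in the negative degree `j +
  -- w`.
  obtain ⟨m, hm, hm'⟩ : ∃ m : ℕ, -(m : ℤ) ≤ M ∧ -(m : ℤ) + w ≤ 0 :=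
    ⟨(max (-M) w).toNat, by omega, by omega⟩
  set F := Lplus.comap (actHom Q) ⊓ Lminus with hF
  have inj : ∀ v ∈ F, (∀ j : ℤ, -(m : ℤ) ≤ j → zcoeff v j = 0) → v = 0 := by
    intro v hv hvm
    by_contra hv0
    obtain ⟨j, hj, hj'⟩ := exists_top_zcoeff hv0
    have hjm : j < -(m : ℤ) := by
      by_contra h
      exact hj (hvm j (by omega))
    have h0 : zcoeff (act v Q) (j + w) = 0 := hv.1 _ (by omega)
    rw [zcoeff_act v Q (j + w) hj' hB (lo := min j (j + w - B)) (min_le_right _ _) le_rfl,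
      Finset.sum_eq_single j] at h0
    · exact mul_ne_zero hj (hM j (by omega)) h0
    · intro i hi hij
      rw [Finset.mem_Icc] at hi
      rw [show j + w = i + (j + w - i) by ring, hw i _ (by omega), mul_zero]
    · intro h; simp at h
  let φ : F →ₗ[ℂ] (Fin m → ℂ) :=
    LinearMap.pi fun k => zcoeffHom (-((k : ℕ) : ℤ) - 1) ∘ₗ F.subtype
  have hφ : Function.Injective φ := by
    rw [← LinearMap.ker_eq_bot, LinearMap.ker_eq_bot']
    rintro ⟨v, hv⟩ h
    refine Subtype.ext (inj v hv fun j hj => ?_)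
    rcases lt_or_ge j 0 with hj0 | hj0
    · have := congrFun h ⟨(-j - 1).toNat, by omega⟩
      change zcoeff v (-((-j - 1).toNat : ℤ) - 1) = 0 at this
      rwa [show -((-j - 1).toNat : ℤ) - 1 = j by omega] at this
    · exact hv.2 j hj0
  refine ⟨F, FiniteDimensional.of_injective φ hφ, fun v hv => ?_⟩
  have ht : truncPlus v ∈ Lplus := (piPlus v).2
  rw [← add_sub_cancel (truncPlus v) v]
  exact Submodule.add_mem_sup ht
    ⟨Submodule.sub_mem _ hv (act_mem_Lplus hQ ht), sub_truncPlus_mem_Lminus v⟩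

/-! ### Annihilators in `𝕃 / 𝕃₊` -/

/-- The Borel transform `∑ⱼ fⱼ zʲ ↦ ∑ₐ f₋ₐ₋₁ (-x)ᵃ / a!`, identifying `𝕃 / 𝕃₊` with `ℂ⟦x⟧`. -/
def borel (f : LL) : ℂ⟦X⟧ :=
  PowerSeries.mk fun a => (-1) ^ a * zcoeff f (-(a : ℤ) - 1) / a.factorial

theorem mem_Lplus_of_borel_eq_zero {f : LL} (h : borel f = 0) : f ∈ Lplus := fun j hj => by
  have := congrArg (PowerSeries.coeff (-j - 1).toNat) h
  rw [borel, PowerSeries.coeff_mk, map_zero, show -((-j - 1).toNat : ℤ) - 1 = j by omega] at this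
  simpa [Nat.factorial_ne_zero] using this

/-- With `borel_act_monomial_zero`, this turns the right action on `𝕃 / 𝕃₊` into differential
operators on `ℂ⟦X⟧`: `∂` becomes `-d/dx`, while a function acts by multiplication. -/
theorem borel_mul_zpow_one (f : LL) :
    borel (f * zpow 1) = -PowerSeries.derivative ℂ (borel f) := by
  obtain ⟨A, hA⟩ := exists_zcoeff_bound f
  have h : ∀ j, zcoeff (f * zpow 1) j = zcoeff f (j - 1) := by
    intro j
    rw [zcoeff_mul f (zpow 1) j (A := max A (j - 1)) (B := 1) (fun i hi => hA i (by omega))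
      (fun i hi => by rw [zcoeff_zpow, if_neg (by omega)]), Finset.sum_eq_single (j - 1)]
    · simp [zcoeff_zpow]
    · intro i _ hi
      rw [zcoeff_zpow, if_neg (by omega), mul_zero]
    · intro h; simp at h
  ext a
  rw [map_neg, PowerSeries.coeff_derivative, borel, borel, PowerSeries.coeff_mk,
    PowerSeries.coeff_mk, h, Nat.factorial_succ, pow_succ,
    show -(a : ℤ) - 1 - 1 = -((a + 1 : ℕ) : ℤ) - 1 by push_cast; ring]
  have h1 : (a.factorial : ℂ) ≠ 0 := by exact_mod_cast a.factorial_ne_zero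
  have h2 : (a : ℂ) + 1 ≠ 0 := by exact_mod_cast a.succ_ne_zero
  push_cast
  field_simp

theorem dpow_monomial_zero (i : ℤ) (q : ℂ⟦X⟧) (n : ℤ) (k : ℕ) (h : i = n + k) :
    dpow i (monomial 0 q) n = (Ring.choose i k : ℤ) • D k q := by
  rw [dpow, finsum_eq_single _ k]
  · simp [h]
  · intro l hl
    rw [coeff_monomial, if_neg (by omega)]
    simp

/-- This identity is what the signs and factorials in `borel` are chosen for: it makes the action of
a function an ordinary product of power series. -/
theorem factorial_mul_choose_neg (b k : ℕ) :
    (b.factorial : ℤ) * (k.factorial * Ring.choose (-(b : ℤ) - 1) k)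
      = (-1) ^ k * (b + k).factorial := by
  have h := Ring.descPochhammer_eq_factorial_smul_choose (-(b : ℤ) - 1) k
  rw [← Polynomial.eval_eq_smeval, nsmul_eq_mul] at h
  have h2 := ascPochhammer_eval_neg_eq_descPochhammer ℤ (-(b : ℤ) - 1) k
  rw [show -(-(b : ℤ) - 1) = ((b + 1 : ℕ) : ℤ) by push_cast; ring, ← ascPochhammer_eval_cast,
    ascPochhammer_nat_eq_ascFactorial] at h2
  rw [← h, ← Nat.factorial_mul_ascFactorial b k, Nat.cast_mul, h2, mul_left_comm, ← mul_assoc _ _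
    (Polynomial.eval _ _), ← mul_pow]
  simp

theorem borel_act_monomial_zero (f : LL) (q : ℂ⟦X⟧) :
    borel (act f (monomial 0 q)) = q * borel f := by
  obtain ⟨A, hA⟩ := exists_zcoeff_bound f
  ext a
  set n : ℤ := -(a : ℤ) - 1 with hn
  rw [PowerSeries.coeff_mul, Finset.Nat.sum_antidiagonal_eq_sum_range_succ_mk]
  rw [borel, PowerSeries.coeff_mk, zcoeff_act f _ n (lo := n) (A := max A (-1))
    (fun j hj => hA j (by omega)) (orderLE_monomial 0 q) (by omega) le_rfl,
    ← Finset.sum_subset (Finset.Icc_subset_Icc_right (le_max_right A (-1))), Finset.mul_sum,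
    Finset.sum_div]
  · symm
    refine Finset.sum_bij (fun k _ => n + k) ?_ ?_ ?_ ?_
    · intro k hk
      rw [Finset.mem_range] at hk
      rw [Finset.mem_Icc]; omega
    · intro k _ l _ h; omega
    · intro i hi
      rw [Finset.mem_Icc] at hi
      exact ⟨(i - n).toNat, by rw [Finset.mem_range]; omega, by omega⟩
    · intro k hk
      rw [Finset.mem_range] at hk
      obtain ⟨b, rfl⟩ : ∃ b, a = b + k := ⟨a - k, by omega⟩
      rw [dpow_monomial_zero _ q n k rfl, map_zsmul, constantCoeff_D, borel, PowerSeries.coeff_mk,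
        show n + (k : ℤ) = -(b : ℤ) - 1 by omega, Nat.add_sub_cancel, zsmul_eq_mul]
      have h := congrArg (Int.cast : ℤ → ℂ) (factorial_mul_choose_neg b k)
      push_cast at h
      have hb : (b.factorial : ℂ) ≠ 0 := by exact_mod_cast b.factorial_ne_zero
      have hbk : ((b + k).factorial : ℂ) ≠ 0 := by exact_mod_cast (b + k).factorial_ne_zero
      rw [← mul_div_assoc, div_eq_div_iff hb hbk, pow_add]
      have hk1 : ((-1 : ℂ) ^ k) * (-1) ^ k = 1 := by rw [← mul_pow]; simp
      set s : ℂ := (-1) ^ k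
      linear_combination (-(-1 : ℂ) ^ b * zcoeff f (-b - 1) * PowerSeries.coeff k q) *
        (s * h + ((b + k).factorial : ℂ) * hk1)
  -- Nonnegative powers of `z` do not contribute: `Ring.choose i (i + a + 1) = 0` for natural `i`.
  · intro i hi hi'
    rw [Finset.mem_Icc] at hi hi'
    lift i to ℕ using (by omega)
    rw [dpow_monomial_zero _ q n (i + a + 1) (by push_cast; omega), Ring.choose_natCast,
      Nat.choose_eq_zero_of_lt (by omega)]
    simp

theorem isDifferential_monomial (m : ℕ) (q : ℂ⟦X⟧) : IsDifferential (monomial m q) :=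
  fun j hj => by rw [coeff_monomial, if_neg (by omega)]

theorem monomial_zero_mul_zpow (q : ℂ⟦X⟧) (m : ℤ) :
    monomial 0 q * constOp (zpow m) = monomial m q := by
  ext1; funext n
  rw [coeff_mul, finsum_eq_single _ 0]
  · rw [dpow_constOp, zcoeff_zpow, coeff_monomial, coeff_monomial, sub_zero, if_pos rfl]
    split_ifs <;> simp
  · intro i hi
    rw [coeff_monomial, if_neg hi, zero_mul]

/-- After the Borel transform one needs an operator killing a single power series `φ`, and a
first-order operator does. -/
theorem exists_annihilator (f : LL) : ∃ Q, IsDifferential Q ∧ Q ≠ 0 ∧ act f Q ∈ Lplus := by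
  by_cases h : borel f = 0
  · refine ⟨1, isDifferential_monomial 0 1, fun h1 => ?_, ?_⟩
    · have := congrArg (fun a : PsiDO => a.coeff 0) h1
      simp [PsiDO.coeff_one] at this
    · rw [act_one]; exact mem_Lplus_of_borel_eq_zero h
  · set φ := borel f
    -- In the right action `φ∂` first multiplies by `φ` and then applies `-d/dx`, giving `-(φ²)' =
    -- -2φφ'`; the term `2φ'` cancels this.
    refine ⟨monomial 1 φ + monomial 0 (2 * PowerSeries.derivative ℂ φ), fun j hj => ?_,
      fun h1 => h ?_, mem_Lplus_of_borel_eq_zero ?_⟩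
    · rw [PsiDO.coeff_add, coeff_monomial, coeff_monomial, if_neg (by omega), if_neg (by omega),
        add_zero]
    · have := congrArg (fun a : PsiDO => a.coeff 1) h1
      simpa using this
    · have hadd : ∀ g g' : LL, borel (g + g') = borel g + borel g' := fun g g' => by
        ext a; simp [borel, zcoeff_add]; ring
      rw [act_add, hadd, borel_act_monomial_zero, ← monomial_zero_mul_zpow, act_mul, act_constOp,
        borel_mul_zpow_one, borel_act_monomial_zero, Derivation.leibniz, smul_eq_mul]
      ring

theorem exists_annihilator_finset (s : Finset LL) :
    ∃ Q, IsDifferential Q ∧ Q ≠ 0 ∧ ∀ f ∈ s, act f Q ∈ Lplus := by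
  classical
  induction s using Finset.induction_on with
  | empty =>
    obtain ⟨Q, hQ, hQ0, -⟩ := exists_annihilator 0
    exact ⟨Q, hQ, hQ0, by simp⟩
  | insert f s _ ih =>
    obtain ⟨Q, hQ, hQ0, hs⟩ := ih
    -- `R` acts after `Q`, so it must annihilate the image of `f` under `Q`; it cannot spoil the
    -- earlier elements because it preserves `𝕃₊`.
    obtain ⟨R, hR, hR0, hf⟩ := exists_annihilator (act f Q)
    refine ⟨Q * R, hQ.mul hR, mul_ne_zero hQ0 hR0, fun g hg => ?_⟩
    rw [act_mul]
    rcases Finset.mem_insert.1 hg with rfl | hg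
    · exact hf
    · exact act_mem_Lplus hR (hs g hg)

theorem exists_annihilator_of_finiteDimensional (F : Submodule ℂ LL) [FiniteDimensional ℂ F] :
    ∃ Q, IsDifferential Q ∧ Q ≠ 0 ∧ F ≤ Lplus.comap (actHom Q) := by
  obtain ⟨s, rfl⟩ := (Submodule.fg_iff_finiteDimensional F).2 inferInstance
  obtain ⟨Q, hQ, hQ0, hs⟩ := exists_annihilator_finset s
  exact ⟨Q, hQ, hQ0, Submodule.span_le.2 hs⟩

/-! ### Fractional operators as almost-stabilizers of `𝕃₊` -/

theorem IsFractional.almostLE {L : PsiDO} (h : IsFractional L) :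
    AlmostLE (Lplus.map (actHom L)) Lplus := by
  obtain ⟨P, Q, hP, hQ, hQ0, h⟩ := h
  refine (AlmostLE.of_le ?_).trans (almostLE_comap_actHom hQ hQ0)
  rintro _ ⟨v, hv, rfl⟩
  rw [Submodule.mem_comap, actHom_apply, actHom_apply, ← act_mul, h]
  exact act_mem_Lplus hP hv

/-- A differential `Q` absorbing the finite-dimensional excess serves as denominator: `L Q`
preserves `𝕃₊`. -/
theorem isFractional_of_almostLE {L : PsiDO} (h : AlmostLE (Lplus.map (actHom L)) Lplus) :
    IsFractional L := by
  obtain ⟨F, hF, hLF⟩ := h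
  obtain ⟨Q, hQ, hQ0, hFQ⟩ := exists_annihilator_of_finiteDimensional F
  refine ⟨L * Q, Q, isDifferential_of_act_mem fun v hv => ?_, hQ, hQ0, rfl⟩
  have hle : Lplus ⊔ F ≤ Lplus.comap (actHom Q) :=
    sup_le (fun v hv => act_mem_Lplus hQ hv) hFQ
  have hv' := hle (hLF (Submodule.mem_map_of_mem (f := actHom L) hv))
  rwa [Submodule.mem_comap, actHom_apply, actHom_apply, ← act_mul] at hv'

/-- An operator is fractional if and only if it preserves `𝕃₊` up to finite dimension. -/
theorem isFractional_iff (L : PsiDO) : IsFractional L ↔ AlmostLE (Lplus.map (actHom L)) Lplus :=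
  ⟨IsFractional.almostLE, isFractional_of_almostLE⟩

/-! ### Successive approximation -/

/-- Operators can be constructed by successive approximation, one coefficient at a time. -/
theorem exists_limit (P : ℕ → PsiDO → Prop) {a₀ : PsiDO} (h₀ : P 0 a₀)
    (step : ∀ n a, P n a → ∃ a', P (n + 1) a' ∧ OrderLE (a' - a) (-(n : ℤ) - 1)) :
    ∃ b, ∀ n : ℕ, ∃ a, P n a ∧ OrderLE (b - a) (-(n : ℤ) - 1) := by
  choose! f hf hf' using step
  let s : ℕ → PsiDO := fun n => Nat.rec a₀ (fun n a => f n a) n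
  have hs : ∀ n, P n (s n) := fun n => by
    induction n with
    | zero => exact h₀
    | succ n ih => exact hf n _ ih
  have hs' : ∀ n k, OrderLE (s (n + k) - s n) (-(n : ℤ) - 1) := fun n k => by
    induction k with
    | zero => intro j _; rw [add_zero, sub_self, coeff_zero]
    | succ k ih =>
      rw [← sub_add_sub_cancel _ (s (n + k))]
      exact ((hf' (n + k) _ (hs _)).mono (by push_cast; omega)).add ih
  obtain ⟨A, hA⟩ := exists_orderLE a₀
  have hs0 : ∀ n j, max A (-1) < j → (s n).coeff j = 0 := fun n j hj => by
    have h := hs' 0 n j (by push_cast; omega)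
    rw [zero_add, PsiDO.coeff_sub, sub_eq_zero] at h
    rw [h]
    exact hA j (by omega)
  -- From stage `-j` on, corrections have order below `j`, so the coefficient of `∂ʲ` is stationary.
  refine ⟨⟨fun j => (s (-j).toNat).coeff j, max A (-1), fun j hj => hs0 _ j hj⟩, fun n =>
    ⟨s n, hs n, fun j hj => ?_⟩⟩
  rw [PsiDO.coeff_sub, sub_eq_zero]
  change (s (-j).toNat).coeff j = _
  obtain ⟨k, hk⟩ : ∃ k, n = (-j).toNat + k := ⟨n - (-j).toNat, by omega⟩
  have h := hs' (-j).toNat k j (by omega)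
  rw [PsiDO.coeff_sub, sub_eq_zero] at h
  rw [hk, h]

/-! ### Invertibility of monic operators of order zero -/

theorem IsMonicOrderZero.orderLE {U : PsiDO} (h : IsMonicOrderZero U) : OrderLE U 0 := h.2

theorem isMonicOrderZero_one : IsMonicOrderZero 1 :=
  ⟨by simp [PsiDO.coeff_one], orderLE_monomial 0 1⟩

theorem isMonicOrderZero_iff {U : PsiDO} : IsMonicOrderZero U ↔ OrderLE (U - 1) (-1) := by
  constructor
  · rintro ⟨h, h'⟩ j hj
    rw [PsiDO.coeff_sub, PsiDO.coeff_one]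
    split_ifs with h0
    · rw [h0, h, sub_self]
    · rw [h' j (by omega), sub_zero]
  · intro h
    refine ⟨?_, fun j hj => ?_⟩
    · have := h 0 (by omega)
      rwa [PsiDO.coeff_sub, PsiDO.coeff_one, if_pos rfl, sub_eq_zero] at this
    · have := h j (by omega)
      rwa [PsiDO.coeff_sub, PsiDO.coeff_one, if_neg (by omega), sub_zero] at this

theorem IsMonicOrderZero.congr {U V : PsiDO} (h : IsMonicOrderZero U) {n : ℕ}
    (hUV : OrderLE (V - U) (-(n : ℤ) - 1)) : IsMonicOrderZero V := by
  rw [isMonicOrderZero_iff] at h ⊢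
  rw [← sub_add_sub_cancel V U]
  exact (hUV.mono (by omega)).add h

theorem IsMonicOrderZero.exists_right_inv {U : PsiDO} (hU : IsMonicOrderZero U) :
    ∃ V, IsMonicOrderZero V ∧ U * V = 1 := by
  have hU1 := isMonicOrderZero_iff.1 hU
  obtain ⟨V, hV⟩ := exists_limit
    (fun n V => IsMonicOrderZero V ∧ OrderLE (U * V - 1) (-(n : ℤ) - 1)) (a₀ := 1)
    ⟨isMonicOrderZero_one, by simpa using hU1⟩ (by
      rintro n V ⟨hV, hUV⟩
      have hd : OrderLE (V - (U * V - 1) - V) (-(n : ℤ) - 1) := by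
        rw [sub_sub_cancel_left]; exact hUV.neg
      -- Subtracting the error multiplies it by `-(U - 1)`, which has order at most `-1`.
      refine ⟨V - (U * V - 1), ⟨hV.congr hd, ?_⟩, hd⟩
      have e : U * (V - (U * V - 1)) - 1 = -((U - 1) * (U * V - 1)) := by noncomm_ring
      rw [e]
      exact ((hU1.mul hUV).neg).mono (by push_cast; omega))
  refine ⟨V, ?_, sub_eq_zero.1 (eq_zero_of_forall_orderLE fun n => ?_)⟩
  · obtain ⟨a, ⟨ha, -⟩, h⟩ := hV 0
    exact ha.congr h
  · obtain ⟨a, ⟨-, ha⟩, h⟩ := hV n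
    have e : U * V - 1 = U * (V - a) + (U * a - 1) := by noncomm_ring
    rw [e]
    exact ((hU.orderLE.mul h).mono (by omega)).add (ha.mono (by omega))

theorem IsMonicOrderZero.isUnit {U : PsiDO} (hU : IsMonicOrderZero U) : IsUnit U := by
  obtain ⟨V, hV, hUV⟩ := hU.exists_right_inv
  obtain ⟨W, -, hVW⟩ := hV.exists_right_inv
  exact isUnit_iff_exists.2 ⟨V, hUV, by rw [left_inv_eq_right_inv hUV hVW, hVW]⟩

/-! ### Conjugating a normalized operator to `∂ᵐ` -/

theorem exists_antiderivative (u : ℂ⟦X⟧) : ∃ v, PowerSeries.derivative ℂ v = u := by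
  refine ⟨PowerSeries.mk fun n => PowerSeries.coeff (n - 1) u / n, ?_⟩
  ext n
  have h : (n : ℂ) + 1 ≠ 0 := by exact_mod_cast n.succ_ne_zero
  rw [PowerSeries.coeff_derivative, PowerSeries.coeff_mk, Nat.add_sub_cancel]
  push_cast
  rw [div_mul_cancel₀ _ h]

/-- A normalized operator of order `m ≠ 0` is conjugate to `∂ᵐ`. -/
theorem IsNormalized.exists_conj {L : PsiDO} {m : ℤ} (hL : IsNormalized L m) (hm : m ≠ 0) :
    ∃ U, IsMonicOrderZero U ∧ L * U = U * constOp (zpow m) := by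
  obtain ⟨h1, h2, h3⟩ := hL
  have hLm : OrderLE L m := h3
  set Z := constOp (zpow m) with hZ
  have hZm : OrderLE Z m := by rw [hZ, constOp_zpow]; exact orderLE_monomial m 1
  have hZ1 : Z.coeff m = 1 := by rw [hZ, constOp_zpow]; simp
  have hZ2 : Z.coeff (m - 1) = 0 := by rw [hZ, constOp_zpow]; simp
  have hm' : (m : ℂ) ≠ 0 := by exact_mod_cast hm
  obtain ⟨U, hU⟩ := exists_limit
    -- Normalization makes `L` and `∂ᵐ` agree in degrees `m` and `m - 1`, so the error starts at
    -- order `m - 2`.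
    (fun n U => IsMonicOrderZero U ∧ OrderLE (L * U - U * Z) (m - 2 - n)) (a₀ := 1)
    ⟨isMonicOrderZero_one, by
      rw [mul_one, one_mul]
      have := ((hLm.sub hZm).pred (by rw [PsiDO.coeff_sub, h1, hZ1, sub_self])).pred
        (by rw [PsiDO.coeff_sub, h2, hZ2, sub_self])
      exact this.mono (by push_cast; omega)⟩ (by
      rintro n U ⟨hU, hLU⟩
      -- Adding `v ∂⁻ⁿ⁻¹` to `U` changes the error by `m v' ∂ᵐ⁻²⁻ⁿ` plus lower terms, the leading
      -- terms of `L T` and `T Z` cancelling. Hence `v'` is prescribed, and `m ≠ 0` is needed to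
      -- solve for it.
      obtain ⟨v, hv⟩ := exists_antiderivative
        (-((m : ℂ)⁻¹ • (L * U - U * Z).coeff (m - 2 - n)))
      set T := monomial (-(n : ℤ) - 1) v with hT
      have hTo : OrderLE T (-(n : ℤ) - 1) := orderLE_monomial _ _
      have hd : OrderLE (U + T - U) (-(n : ℤ) - 1) := by rwa [add_sub_cancel_left]
      refine ⟨U + T, ⟨hU.congr hd, ?_⟩, hd⟩
      have hT1 : T.coeff (-(n : ℤ) - 1) = v := by simp [hT]
      have hT2 : T.coeff (-(n : ℤ) - 1 - 1) = 0 := by simp [hT]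
      have hc : OrderLE (L * T - T * Z) (m - 2 - n) := by
        have h4 : OrderLE (L * T - T * Z) (m + (-(n : ℤ) - 1)) :=
          (hLm.mul hTo).sub ((hTo.mul hZm).mono (by omega))
        refine (h4.pred ?_).mono (by omega)
        rw [PsiDO.coeff_sub, coeff_mul_top hLm hTo, add_comm m, coeff_mul_top hTo hZm, h1, hZ1,
          hT1]
        simp
      have hc' : (L * T - T * Z).coeff (m - 2 - n) = -(L * U - U * Z).coeff (m - 2 - n) := by
        rw [PsiDO.coeff_sub, show m - 2 - (n : ℤ) = m + (-(n : ℤ) - 1) - 1 by ring,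
          coeff_mul_top_pred hLm hTo, add_comm m (-(n : ℤ) - 1), coeff_mul_top_pred hTo hZm, h1,
          h2, hZ1, hZ2, hT1, hT2, hv, Derivation.map_one_eq_zero]
        rw [show m - 2 - (n : ℤ) = -(n : ℤ) - 1 + m - 1 by ring]
        simp only [mul_zero, zero_mul, smul_zero, add_zero, zero_add, sub_zero,
          one_mul, smul_neg]
        rw [← Int.cast_smul_eq_zsmul ℂ, smul_smul, mul_inv_cancel₀ hm', one_smul]
      have e : L * (U + T) - (U + T) * Z = (L * U - U * Z) + (L * T - T * Z) := by noncomm_ring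
      rw [e]
      refine ((hLU.add hc).pred ?_).mono (by push_cast; omega)
      rw [PsiDO.coeff_add, hc', add_neg_cancel])
  refine ⟨U, ?_, sub_eq_zero.1 (eq_zero_of_forall_orderLE fun n => ?_)⟩
  · obtain ⟨a, ⟨ha, -⟩, h⟩ := hU 0
    exact ha.congr h
  -- The extra `|m|` stages absorb the shift of order caused by `L` and `Z`.
  · obtain ⟨a, ⟨-, ha⟩, h⟩ := hU (n + m.toNat + (-m).toNat)
    have e : L * U - U * Z = L * (U - a) - (U - a) * Z + (L * a - a * Z) := by noncomm_ring
    rw [e]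
    push_cast at ha h
    exact (((hLm.mul h).mono (by omega)).sub ((h.mul hZm).mono (by omega))).add
      (ha.mono (by omega))

/-! ### Centralizers of operators with constant coefficients -/

/-- An operator commuting with a nonconstant operator with constant coefficients has itself
constant coefficients. -/
theorem eq_constOp_of_commute {f : LL} (hf : f ∉ constants) {N : PsiDO}
    (h : constOp f * N = N * constOp f) : N = constOp (atZero N) := by
  -- Removing the constant term does not change the centralizer, and it forces the top degree `m` to
  -- be nonzero.
  set f' := f - algebraMap ℂ LL (zcoeff f 0) with hf'
  have hf0 : f' ≠ 0 := fun h0 => hf ⟨zcoeff f 0, (sub_eq_zero.1 h0).symm⟩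
  obtain ⟨m, hm, hmtop⟩ := exists_top_zcoeff hf0
  have hm0 : (m : ℂ) ≠ 0 := by
    rw [Int.cast_ne_zero]
    rintro rfl
    apply hm
    rw [hf', zcoeff_sub, zcoeff_algebraMap, if_pos rfl, sub_self]
  -- `R` still commutes with `f(∂)`, and all its coefficients vanish at `x = 0`.
  set R := N - constOp (atZero N) with hR
  have hcomm : constOp f' * R = R * constOp f' := by
    have e : constOp f' = constOp f - algebraMap ℂ PsiDO (zcoeff f 0) := by
      rw [← constOp_algebraMap]; exact map_sub constOpHom _ _
    rw [e, sub_mul, mul_sub R, ← Algebra.commutes]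
    congr 1
    rw [hR, mul_sub, sub_mul, h, constOp_comm]
  by_contra hN
  obtain ⟨i, hi, hi'⟩ := exists_leading (a := R) (sub_ne_zero.2 hN)
  have hfm := orderLE_constOp hmtop
  have h1 := congrArg (fun a : PsiDO => a.coeff (m + i - 1)) hcomm
  simp only [coeff_mul_top_pred hfm hi] at h1
  rw [add_comm m i, coeff_mul_top_pred hi hfm, coeff_constOp, coeff_constOp,
    PowerSeries.derivative_C] at h1
  -- The subleading coefficient of the commutator shows that the leading coefficient of `R` has zero
  -- derivative; vanishing at `x = 0`, it is then zero.
  have h2 : m • (PowerSeries.C (zcoeff f' m) * PowerSeries.derivative ℂ (R.coeff i)) = 0 := by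
    rw [mul_zero, smul_zero, add_zero] at h1
    linear_combination h1
  rw [← Int.cast_smul_eq_zsmul ℂ, ← PowerSeries.smul_eq_C_mul, smul_smul,
    smul_eq_zero_iff_right (mul_ne_zero hm0 hm)] at h2
  refine hi' (PowerSeries.derivative.ext (by rw [h2, map_zero]) ?_)
  rw [hR, PsiDO.coeff_sub, map_sub, coeff_constOp, PowerSeries.constantCoeff_C, zcoeff_atZero,
    sub_self, map_zero]

/-! ### The spectral field and its operators -/

theorem actHom_constOp (f : LL) : actHom (constOp f) = LinearMap.mulLeft ℂ f :=
  LinearMap.ext fun v => by rw [actHom_apply, act_constOp, mul_comm, LinearMap.mulLeft_apply]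

/-- The spectral field of `W` as a subalgebra of `𝕃`. -/
def spectralSubalgebra (W : Submodule ℂ LL) : Subalgebra ℂ LL where
  carrier := spectralField W
  mul_mem' {f g} hf hg := by
    rw [mem_spectralField_iff] at *
    rw [LinearMap.mulLeft_mul, Submodule.map_comp]
    exact (hg.map _).trans hf
  add_mem' {f g} hf hg := by
    rw [mem_spectralField_iff] at *
    refine (AlmostLE.of_le ?_).trans (hf.sup hg)
    rw [Submodule.map_le_iff_le_comap]
    intro v hv
    rw [Submodule.mem_comap, LinearMap.mulLeft_apply, add_mul]
    exact Submodule.add_mem_sup (Submodule.mem_map_of_mem hv) (Submodule.mem_map_of_mem hv)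
  algebraMap_mem' c := by
    rw [mem_spectralField_iff]
    refine AlmostLE.of_le ?_
    rw [Submodule.map_le_iff_le_comap]
    intro v hv
    rw [Submodule.mem_comap, LinearMap.mulLeft_apply, ← Algebra.smul_def]
    exact W.smul_mem c hv

section Conjugation

variable {U : PsiDO}

/-- Applying the invertible map `actHom U` to the criterion `isFractional_iff` carries `𝕃₊` to `𝕃₊ ·
U` and the conjugated operator to multiplication by `f`. -/
theorem conj_constOp_isFractional_iff (hU : IsUnit U) (f : LL) :
    IsFractional (U * constOp f * Ring.inverse U) ↔
      f ∈ spectralField (Lplus.map (actHom U)) := by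
  have h1 : ∀ S : Submodule ℂ LL, (S.map (actHom U)).map (actHom (Ring.inverse U)) = S := by
    intro S
    rw [← Submodule.map_comp, ← actHom_mul, Ring.mul_inverse_cancel U hU,
      LinearMap.ext act_one (f := actHom 1) (g := LinearMap.id), Submodule.map_id]
  have h2 : ∀ S : Submodule ℂ LL, (S.map (actHom (Ring.inverse U))).map (actHom U) = S := by
    intro S
    rw [← Submodule.map_comp, ← actHom_mul, Ring.inverse_mul_cancel U hU,
      LinearMap.ext act_one (f := actHom 1) (g := LinearMap.id), Submodule.map_id]
  rw [isFractional_iff, mem_spectralField_iff, actHom_mul, actHom_mul, actHom_constOp,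
    Submodule.map_comp, Submodule.map_comp]
  constructor <;> intro h
  · have := h.map (actHom U)
    rwa [h2] at this
  · have := h.map (actHom (Ring.inverse U))
    rwa [h1] at this

/-- The algebra homomorphism `f ↦ U f(∂) U⁻¹`. -/
def conjHom (hU : IsUnit U) : LL →ₐ[ℂ] PsiDO where
  toFun f := U * constOp f * Ring.inverse U
  map_one' := by
    rw [← constOpHom_apply, map_one, mul_one, Ring.mul_inverse_cancel U hU]
  map_mul' f g := by
    calc U * constOp (f * g) * Ring.inverse U
        = U * constOp f * 1 * constOp g * Ring.inverse U := by
          rw [constOp_mul, mul_one, mul_assoc U (constOp f)]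
      _ = U * constOp f * Ring.inverse U * (U * constOp g * Ring.inverse U) := by
          rw [← Ring.inverse_mul_cancel U hU]; simp only [mul_assoc]
  map_zero' := by rw [← constOpHom_apply, map_zero, mul_zero, zero_mul]
  map_add' f g := by
    rw [← constOpHom_apply, map_add, mul_add, add_mul]; rfl
  commutes' c := by
    rw [constOp_algebraMap, ← Algebra.commutes, mul_assoc, Ring.mul_inverse_cancel U hU, mul_one]

/-- The algebra `𝒦_W` for `W = 𝕃₊ · U`. -/
def spectralAlgebra (hU : IsUnit U) : Subalgebra ℂ PsiDO :=
  (spectralSubalgebra (Lplus.map (actHom U))).map (conjHom hU)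

theorem coe_spectralAlgebra (hU : IsUnit U) :
    (spectralAlgebra hU : Set PsiDO) = spectralOps (Lplus.map (actHom U)) U := by
  ext L
  exact ⟨fun ⟨f, hf, h⟩ => ⟨f, hf, h.symm⟩, fun ⟨f, hf, h⟩ => ⟨f, hf, h.symm⟩⟩

theorem isCommFractionalAlgebra_spectralAlgebra (hU : IsUnit U) :
    IsCommFractionalAlgebra (spectralAlgebra hU) := by
  constructor
  · rintro _ ⟨f, hf, rfl⟩
    exact (conj_constOp_isFractional_iff hU f).2 hf
  · rintro _ ⟨f, -, rfl⟩ _ ⟨g, -, rfl⟩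
    exact (map_mul (conjHom hU) f g).symm.trans
      ((congrArg _ (mul_comm f g)).trans (map_mul (conjHom hU) g f))

/-- A fractional operator commuting with `U f(∂) U⁻¹`, for a nonconstant `f`, lies in `𝒦_W`. -/
theorem mem_spectralAlgebra_of_commute (hU : IsUnit U) {f : LL} (hf : f ∉ constants) {M : PsiDO}
    (hM : IsFractional M)
    (h : U * constOp f * Ring.inverse U * M = M * (U * constOp f * Ring.inverse U)) :
    M ∈ spectralAlgebra hU := by
  set V := Ring.inverse U
  have hUV : U * V = 1 := Ring.mul_inverse_cancel U hU
  have hVU : V * U = 1 := Ring.inverse_mul_cancel U hU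
  have hc : constOp f * (V * M * U) = V * M * U * constOp f := by
    calc constOp f * (V * M * U) = (V * U) * constOp f * (V * M * U) := by rw [hVU, one_mul]
      _ = V * (U * constOp f * V * M) * U := by simp only [mul_assoc]
      _ = V * M * U * constOp f * (V * U) := by rw [h]; simp only [mul_assoc]
      _ = _ := by rw [hVU, mul_one]
  have hg := eq_constOp_of_commute hf hc
  have hMg : U * constOp (atZero (V * M * U)) * V = M := by
    rw [← hg]
    calc U * (V * M * U) * V = (U * V) * M * (U * V) := by simp only [mul_assoc]
      _ = M := by rw [hUV, one_mul, mul_one]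
  refine ⟨atZero (V * M * U), (conj_constOp_isFractional_iff hU _).1 ?_, hMg⟩
  rwa [hMg]

/-- This containment yields both maximality of `𝒦_W` and the identification of a given maximal
algebra with some `𝒦_W`. -/
theorem IsCommFractionalAlgebra.le_spectralAlgebra (hU : IsUnit U) {A : Subalgebra ℂ PsiDO}
    (hA : IsCommFractionalAlgebra A) {f : LL} (hf : f ∉ constants)
    (hfA : U * constOp f * Ring.inverse U ∈ A) : A ≤ spectralAlgebra hU := fun M hM =>
  mem_spectralAlgebra_of_commute hU hf (hA.1 M hM) (hA.2 _ hfA M hM)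

theorem isMaximal_spectralAlgebra (hU : IsUnit U)
    (h : spectralField (Lplus.map (actHom U)) ≠ constants) :
    IsMaximalCommFractionalAlgebra (spectralAlgebra hU) := by
  refine ⟨isCommFractionalAlgebra_spectralAlgebra hU, fun B hB hle => ?_⟩
  obtain ⟨f, hf, hfc⟩ : ∃ f ∈ spectralField (Lplus.map (actHom U)), f ∉ constants := by
    by_contra! hcon
    refine h (Set.Subset.antisymm hcon ?_)
    rintro _ ⟨c, rfl⟩
    exact (spectralSubalgebra _).algebraMap_mem c
  exact hB.le_spectralAlgebra hU hfc (hle ⟨f, hf, rfl⟩)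

end Conjugation

/-! ### Operators and the big cell -/

theorem IsMonicOrderZero.zcoeff_act_top {U : PsiDO} (hU : IsMonicOrderZero U) {v : LL} {j : ℤ}
    (hj : ∀ i, j < i → zcoeff v i = 0) : zcoeff (act v U) j = zcoeff v j := by
  rw [zcoeff_act v U j hj hU.orderLE (lo := j) (by omega) le_rfl, Finset.Icc_self,
    Finset.sum_singleton]
  have := dpow_top hU.orderLE j
  rw [add_zero] at this
  rw [this, hU.1, map_one, mul_one]

theorem IsMonicOrderZero.zcoeff_act_of_lt {U : PsiDO} (hU : IsMonicOrderZero U) {v : LL} {j : ℤ}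
    (hj : ∀ i, j < i → zcoeff v i = 0) {i : ℤ} (hi : j < i) : zcoeff (act v U) i = 0 := by
  rw [zcoeff_act v U i hj hU.orderLE (lo := i) (by omega) le_rfl, Finset.Icc_eq_empty (by omega),
    Finset.sum_empty]

/-- `U` preserves the top term of every series, so `π₊` composed with its action is unipotent
triangular on `ℂ[z]`, hence bijective. -/
theorem IsMonicOrderZero.map_mem_bigCell {U : PsiDO} (hU : IsMonicOrderZero U) :
    Lplus.map (actHom U) ∈ BigCell := by
  constructor
  · rw [← LinearMap.ker_eq_bot, LinearMap.ker_eq_bot']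
    rintro ⟨w, v, hv, rfl⟩ h
    refine Subtype.ext ?_
    change act v U = 0
    suffices v = 0 by rw [this]; exact map_zero (actHom U)
    by_contra hv0
    obtain ⟨j, hj, hj'⟩ := exists_top_zcoeff hv0
    have hj0 : 0 ≤ j := by
      by_contra hneg
      exact hj (hv j (by omega))
    have h1 := congrArg (fun x : Lplus => zcoeff x j) h
    change zcoeff (truncPlus (act v U)) j = 0 at h1
    rw [zcoeff_truncPlus, if_pos hj0, hU.zcoeff_act_top hj'] at h1
    exact hj h1
  · suffices h : ∀ n : ℕ, ∀ p ∈ Lplus, (∀ j : ℤ, (n : ℤ) ≤ j → zcoeff p j = 0) →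
        ∃ v ∈ Lplus, truncPlus (act v U) = p by
      rintro ⟨p, hp⟩
      obtain ⟨N, hN⟩ := exists_zcoeff_bound p
      obtain ⟨v, hv, hvp⟩ := h (N + 1).toNat p hp fun j hj => hN j (by omega)
      exact ⟨⟨act v U, v, hv, rfl⟩, Subtype.ext hvp⟩
    intro n
    induction n with
    | zero =>
      intro p hp h
      refine ⟨0, Lplus.zero_mem, LL.ext fun j => ?_⟩
      have h0 : act 0 U = 0 := map_zero (actHom U)
      rw [h0, zcoeff_truncPlus, zcoeff_zero, ite_self]
      rcases lt_or_ge j 0 with hj | hj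
      · exact (hp j hj).symm
      · exact (h j hj).symm
    | succ n ih =>
      intro p hp h
      -- Subtracting the image of the top term of `p` lowers the degree.
      set t : LL := zcoeff p n • zpow n with ht
      have htop : ∀ i, (n : ℤ) < i → zcoeff t i = 0 := fun i hi => by
        rw [ht, zcoeff_smul, zcoeff_zpow, if_neg (by omega), mul_zero]
      have htL : t ∈ Lplus := fun i hi => by
        rw [ht, zcoeff_smul, zcoeff_zpow, if_neg (by omega), mul_zero]
      obtain ⟨v, hv, hvp⟩ := ih (p - truncPlus (act t U))
        (Lplus.sub_mem hp (piPlus (act t U)).2) (fun j hj => by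
          rw [zcoeff_sub, zcoeff_truncPlus, if_pos (by omega)]
          rcases hj.eq_or_lt with rfl | hj
          · rw [hU.zcoeff_act_top htop, ht, zcoeff_smul, zcoeff_zpow, if_pos rfl, mul_one,
              sub_self]
          · rw [hU.zcoeff_act_of_lt htop hj, h j (by push_cast; omega), sub_zero])
      refine ⟨v + t, Lplus.add_mem hv htL, ?_⟩
      have hadd : truncPlus (act (v + t) U) = truncPlus (act v U) + truncPlus (act t U) := by
        have := congrArg (fun x : Lplus => (x : LL))
          (map_add (piPlus ∘ₗ actHom U) v t)
        exact this
      rw [hadd, hvp, sub_add_cancel]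

theorem zpow_notMem_constants {m : ℤ} (hm : m ≠ 0) : zpow m ∉ constants := by
  rintro ⟨c, hc⟩
  have := congrArg (fun f => zcoeff f m) hc
  simp [zcoeff_algebraMap, zcoeff_zpow, hm] at this

end SatoFractional

end

open SatoFractional
theorem theoremB :
    (∀ W ∈ BigCell, ∀ U : PsiDO, IsMonicOrderZero U →
      (W : Set LL) = (fun v : LL => act v U) '' (Lplus : Set LL) →
      ∃ A : Subalgebra ℂ PsiDO, (A : Set PsiDO) = spectralOps W U ∧
        IsCommFractionalAlgebra A ∧
        (spectralField W ≠ constants → IsMaximalCommFractionalAlgebra A)) ∧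
    (∀ A : Subalgebra ℂ PsiDO, IsMaximalCommFractionalAlgebra A →
      (∃ L ∈ A, ∃ m : ℤ, m ≠ 0 ∧ IsNormalized L m) →
      ∃ W ∈ BigCell, ∃ U : PsiDO, IsMonicOrderZero U ∧
        (W : Set LL) = (fun v : LL => act v U) '' (Lplus : Set LL) ∧
        spectralField W ≠ constants ∧
        (A : Set PsiDO) = spectralOps W U) := by
  constructor
  · intro W _ U hU hW
    obtain rfl : W = Lplus.map (actHom U) := SetLike.coe_injective hW
    exact ⟨spectralAlgebra hU.isUnit, coe_spectralAlgebra hU.isUnit,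
      isCommFractionalAlgebra_spectralAlgebra hU.isUnit, isMaximal_spectralAlgebra hU.isUnit⟩
  · rintro A hA ⟨L, hL, m, hm, hLm⟩
    obtain ⟨U, hU, hLU⟩ := hLm.exists_conj hm
    have hLeq : U * constOp (zpow m) * Ring.inverse U = L := by
      rw [← hLU, mul_assoc, Ring.mul_inverse_cancel U hU.isUnit, mul_one]
    have hc := zpow_notMem_constants hm
    -- Fractionality of `L = U ∂ᵐ U⁻¹` puts the nonconstant `zᵐ` into `K_W`.
    refine ⟨Lplus.map (actHom U), hU.map_mem_bigCell, U, hU, rfl, fun h => hc ?_, ?_⟩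
    · rw [← h, ← conj_constOp_isFractional_iff hU.isUnit, hLeq]
      exact hA.1.1 L hL
    · have hle := hA.1.le_spectralAlgebra hU.isUnit hc (hLeq.symm ▸ hL)
      rw [← coe_spectralAlgebra hU.isUnit]
      exact congrArg _ (le_antisymm hle
        (hA.2 (isCommFractionalAlgebra_spectralAlgebra hU.isUnit) hle))
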